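/- A globular set $X$ consists of sets $X_n$ ($n\in\mathbb N$) of $n$-vertices and maps $s,t\colon X_{n+1}\to X_n$ with $ss=st$ and $tt=ts$. Let $\blacktriangleleft$ be the preorder on the set of all vertices generated by $s(y)\blacktriangleleft y$ and $y\blacktriangleleft t(y)$. A *globular cardinal* is a globular set with finitely many vertices for which $\blacktriangleleft$ is a linear order. For consecutive $y,z\in X_n$ (distinct, with no other $n$-vertex between $y$ and $z$), $X[y,z]$ is the largest globular subset $S$ of $X$ with $S_n=\{y,z\}$. For consecutive $y,z\in X_0$, $X(y,z)$ is the globular cardinal of all vertices of positive dimension that lie between $y$ and $z$ (the largest globular subset of $(X_{n+1})_n$ with all vertices between $y$ and $z$). A morphism $\gamma\colon Y\to X$ restricts to $\gamma(y,z)\colon Y(y,z)\to X(\gamma y,\gamma z)$. *$\omega$-categories* are strict and of finite dimension; an $n$-cell is identified with the identities on it. An $\omega$-category is given by its cells, its $n$-cells, the $m$-domain and $m$-codomain of each cell, and the $m$-composition $\beta\circ_m\alpha$ of cells with $\mathrm{dom}_m\beta=\mathrm{cod}_m\alpha$. *The free $\omega$-category $\mathfrak F X$ on a globular cardinal $X$.*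 Its $n$-cells are the isomorphism classes, over $X$, of morphisms $\gamma\colon Y\to X$ with $Y$ a non-empty globular cardinal without vertices of dimension $>n$. The $m$-source $\sigma_mY$ (resp. $m$-target $\tau_mY$) is, for $m=0$, the smallest globular subset containing the least (resp. greatest) vertex of $Y$, and for $m\ge1$ the smallest globular subset that contains $Y_\ell$ for all $\ell<m$ and the least (resp. greatest) element of $Y[y,z]_m$, where one exists, for all consecutive $y,z\in Y_{m-1}$. The $m$-domain (resp. $m$-codomain) of $[\gamma]$ is the class of the composite $\sigma_mY\hookrightarrow Y\to X$ (resp. $\tau_mY\hookrightarrow Y\to X$). If $\alpha\colon Y\to X$ and $\beta\colon Z\to X$ have $\mathrm{dom}_m\beta=\mathrm{cod}_m\alpha$, then $\beta\circ_m\alpha$ is the class of the morphism to $X$ induced on the pushout of $Z\hookleftarrow\sigma_mZ\cong\tau_mY\hookrightarrow Y$, where the isomorphism is over $X$. *Ordinal graphs.* An ordinal graph $\mathcal G$ is, recursively, a finite linearly ordered set of vertices with, for each pair $x,y$ of vertices, an ordinal graph $\mathcal G(x,y)$ that is non-empty if and only if $y$ is the successor of $x$. The ordinal graph $\Gamma X$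 of a globular cardinal $X$ has vertex set $X_0$ and $(\Gamma X)(y,z)=\Gamma(X(y,z))$ for consecutive $y,z$. *The free $\omega$-category $\mathfrak F\mathcal G$ on a graph $\mathcal G$.* Its objects are the vertices of $\mathcal G$; the hom-object from $x$ to $y$ is $$\sum_{x=x_0,\dots,x_n=y}\mathfrak F(\mathcal G(x_{n-1},x_n))\times\dots\times\mathfrak F(\mathcal G(x_0,x_1)),$$ the sum being over all finite sequences of vertices from $x$ to $y$; for $x=y$ the sequence of length $n=0$ contributes a terminal $\omega$-category. So a $0$-cell is a vertex, an $(n+1)$-cell is a sequence of $n$-cells of the $\mathfrak F(\mathcal G(x_{i-1},x_i))$, $0$-composition is concatenation, and the $(m+1)$-domain, $(m+1)$-codomain and $(m+1)$-composition are the $m$-domain, $m$-codomain and $m$-composition in each entry. *The functor $L\colon\mathfrak F X\to\mathfrak F\Gamma X$.* It sends the class of $\gamma\colon Y\to X$, where $Y_0=\{y_0<\dots<y_p\}$, to the sequence $\bigl(L(\gamma(y_{i-1},y_i))\bigr)_{i=1}^p$ from $\gamma(y_0)$ to $\gamma(y_p)$, whose $i$-th entry is a cell of $\mathfrak F\bigl((\Gamma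 X)(\gamma y_{i-1},\gamma y_i)\bigr)$; for $p=0$ it is the object $\gamma(y_0)$. **Lemma.** For every globular cardinal $X$, $\mathfrak F X$ and $\mathfrak F\Gamma X$ are $\omega$-categories and $L\colon\mathfrak F X\to\mathfrak F\Gamma X$ is an isomorphism of $\omega$-categories. -/

import Mathlib

open CategoryTheory

universe u v w

/-! ## Globular sets -/

/-- A globular set: `src` and `tgt` are the source and target maps. -/
structure GlobSet where
  cell : ℕ → Type u
  src : ∀ {n : ℕ}, cell (n + 1) → cell n
  tgt : ∀ {n : ℕ}, cell (n + 1) → cell n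
  src_tgt : ∀ {n : ℕ} (x : cell (n + 2)), src (tgt x) = src (src x)
  tgt_src : ∀ {n : ℕ} (x : cell (n + 2)), tgt (src x) = tgt (tgt x)

namespace GlobSet

/-- A morphism of globular sets. -/
@[ext]
structure Hom (X Y : GlobSet.{u}) where
  app : ∀ {n : ℕ}, X.cell n → Y.cell n
  app_src : ∀ {n : ℕ} (x : X.cell (n + 1)), app (X.src x) = Y.src (app x)
  app_tgt : ∀ {n : ℕ} (x : X.cell (n + 1)), app (X.tgt x) = Y.tgt (app x)

instance : Category GlobSet.{u} where
  Hom := Hom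
  id X := ⟨fun x => x, fun _ => rfl, fun _ => rfl⟩
  comp f g := ⟨fun x => g.app (f.app x), fun x => by rw [f.app_src, g.app_src],
    fun x => by rw [f.app_tgt, g.app_tgt]⟩

/-- All vertices of a globular set, each with its dimension. -/
abbrev Vertex (X : GlobSet.{u}) : Type u := Σ n : ℕ, X.cell n

/-- The generating relation `x ≺ y`: `x = s(y)` or `y = t(x)`. -/
inductive Prec (X : GlobSet.{u}) : X.Vertex → X.Vertex → Prop
  | src {n : ℕ} (y : X.cell (n + 1)) : Prec X ⟨n, X.src y⟩ ⟨n + 1, y⟩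
  | tgt {n : ℕ} (x : X.cell (n + 1)) : Prec X ⟨n + 1, x⟩ ⟨n, X.tgt x⟩

/-- The order `x ◂ y` generated by `≺`. -/
def le (X : GlobSet.{u}) : X.Vertex → X.Vertex → Prop := Relation.ReflTransGen X.Prec

/-- `X` has dimension (at most) `n`: there are no vertices above dimension `n`. -/
def DimLE (X : GlobSet.{u}) (n : ℕ) : Prop := ∀ m, n < m → IsEmpty (X.cell m)

/-- `x` and `y` are consecutive in the set of `n`-vertices, `x` coming first. -/
def Consec (X : GlobSet.{u}) {n : ℕ} (x y : X.cell n) : Prop :=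
  x ≠ y ∧ {z : X.cell n | X.le ⟨n, x⟩ ⟨n, z⟩ ∧ X.le ⟨n, z⟩ ⟨n, y⟩} = {x, y}

/-- A finite set of vertices, and the generated order is linear. -/
structure IsCard (X : GlobSet.{u}) : Prop where
  finite : Finite X.Vertex
  antisymm : ∀ x y, X.le x y → X.le y x → x = y
  total : ∀ x y, X.le x y ∨ X.le y x

/-- A subfunctor of a globular set. -/
@[ext]
structure Sub (X : GlobSet.{u}) where
  mem : ∀ n : ℕ, Set (X.cell n)
  src_mem : ∀ {n : ℕ} {x : X.cell (n + 1)}, x ∈ mem (n + 1) → X.src x ∈ mem n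
  tgt_mem : ∀ {n : ℕ} {x : X.cell (n + 1)}, x ∈ mem (n + 1) → X.tgt x ∈ mem n

namespace Sub

variable {X : GlobSet.{u}}

/-- The globular set underlying a subfunctor. -/
def toGlobSet (S : X.Sub) : GlobSet.{u} where
  cell n := {x : X.cell n // x ∈ S.mem n}
  src x := ⟨X.src x.1, S.src_mem x.2⟩
  tgt x := ⟨X.tgt x.1, S.tgt_mem x.2⟩
  src_tgt x := Subtype.ext (X.src_tgt x.1)
  tgt_src x := Subtype.ext (X.tgt_src x.1)

/-- The inclusion of a subfunctor. -/
def incl (S : X.Sub) : S.toGlobSet ⟶ X where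
  app x := x.1
  app_src _ := rfl
  app_tgt _ := rfl

/-- The smallest subfunctor containing a set of vertices. -/
def smallest (B : Set X.Vertex) : X.Sub where
  mem n := {x | ∀ S : X.Sub, (∀ v ∈ B, v.2 ∈ S.mem v.1) → x ∈ S.mem n}
  src_mem h S hS := S.src_mem (h S hS)
  tgt_mem h S hS := S.tgt_mem (h S hS)

/-- The union of all the subfunctors with the property `P`. When this union itself has the
property, it is the largest subfunctor with the property. -/
def largest (P : X.Sub → Prop) : X.Sub where
  mem n := {x | ∃ S : X.Sub, P S ∧ x ∈ S.mem n}
  src_mem := fun ⟨S, hS, h⟩ => ⟨S, hS, S.src_mem h⟩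
  tgt_mem := fun ⟨S, hS, h⟩ => ⟨S, hS, S.tgt_mem h⟩

end Sub

/-- The composite of `X` with the shift `i ↦ i + 1` of the index category. -/
def shift (X : GlobSet.{u}) : GlobSet.{u} where
  cell n := X.cell (n + 1)
  src x := X.src x
  tgt x := X.tgt x
  src_tgt x := X.src_tgt x
  tgt_src x := X.tgt_src x

/-- For consecutive `0`-vertices `y`, `z`: the restriction `X(y,z)`, that is, the largest
subfunctor of the shift of `X` all whose vertices lie between `y` and `z`.
It is empty when `y`, `z` are not consecutive. -/
def restrSub (X : GlobSet.{u}) (y z : X.cell 0) : X.shift.Sub :=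
  Sub.largest fun S => X.Consec y z ∧ ∀ (n : ℕ) (x : X.cell (n + 1)), x ∈ S.mem n →
    X.le ⟨0, y⟩ ⟨n + 1, x⟩ ∧ X.le ⟨n + 1, x⟩ ⟨0, z⟩

/-- For consecutive `n`-vertices `y`, `z`: the largest subfunctor of `X` whose set of
`n`-vertices is `{y, z}`. -/
def compSub (X : GlobSet.{u}) {n : ℕ} (y z : X.cell n) : X.Sub :=
  Sub.largest fun S => S.mem n = {y, z}

/-- The order `◂` (`ε = false`) or its opposite (`ε = true`), so that least elements for
`ord false` are the least and least elements for `ord true` are the greatest ones. -/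
def ord (X : GlobSet.{u}) (ε : Bool) (x y : X.Vertex) : Prop :=
  if ε then X.le y x else X.le x y

/-- The vertices that generate the `m`-source (`ε = false`) or `m`-target (`ε = true`).
For `m = 0`: the least (greatest) element. For `m = k + 1`: all vertices of dimension `≤ k`
and, for each pair `y`, `z` of consecutive `k`-vertices, the least (greatest) of the
`m`-vertices in `compSub y z`. -/
def bdryGen (X : GlobSet.{u}) (ε : Bool) : ℕ → Set X.Vertex
  | 0 => {v | ∀ w, X.ord ε v w}
  | k + 1 => {v | v.1 ≤ k} ∪ {v | ∃ (x : X.cell (k + 1)) (y z : X.cell k), v = ⟨k + 1, x⟩ ∧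
      X.Consec y z ∧ x ∈ (X.compSub y z).mem (k + 1) ∧
      ∀ x' ∈ (X.compSub y z).mem (k + 1), X.ord ε ⟨k + 1, x⟩ ⟨k + 1, x'⟩}

/-- The `m`-source (`ε = false`) and the `m`-target (`ε = true`) of `X`. -/
def bdry (X : GlobSet.{u}) (ε : Bool) (m : ℕ) : X.Sub := Sub.smallest (X.bdryGen ε m)

/-! ### Facts on globular sets needed for the constructions below -/

section Facts

variable {X Y : GlobSet.{u}}

/-- `w` lies in the hom from the `k`-vertex `a` to the `k`-vertex `b`. -/
def InHom (X : GlobSet.{u}) {k : ℕ} (a b : X.cell k) : ∀ {n : ℕ}, X.cell n → Prop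
  | 0, _ => False
  | n + 1, w => (∃ h : n = k, X.src w = cast (by rw [h]) a ∧ X.tgt w = cast (by rw [h]) b) ∨
      InHom X a b (X.src w)

theorem inHom_base {k : ℕ} (w : X.cell (k + 1)) : X.InHom (X.src w) (X.tgt w) w :=
  Or.inl ⟨rfl, rfl, rfl⟩

theorem InHom.lt {k : ℕ} {a b : X.cell k} : ∀ {n : ℕ} {w : X.cell n}, X.InHom a b w → k < n
  | 0, _, h => h.elim
  | n + 1, w, h => by
    rcases h with ⟨rfl, _⟩ | h
    · omega
    · exact Nat.lt_succ_of_lt h.lt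

theorem InHom.base {k : ℕ} {a b : X.cell k} {w : X.cell (k + 1)} (h : X.InHom a b w) :
    X.src w = a ∧ X.tgt w = b := by
  rcases h with ⟨_, h⟩ | h
  · exact h
  · exact absurd h.lt (lt_irrefl _)

theorem inHom_base_iff {k : ℕ} {a b : X.cell k} {w : X.cell (k + 1)} :
    X.InHom a b w ↔ X.src w = a ∧ X.tgt w = b :=
  ⟨InHom.base, by rintro ⟨rfl, rfl⟩; exact inHom_base w⟩

theorem inHom_src_iff_tgt {k : ℕ} {a b : X.cell k} :
    ∀ {n : ℕ} (w : X.cell (n + 1)), X.InHom a b (X.src w) ↔ X.InHom a b (X.tgt w)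
  | 0, _ => Iff.rfl
  | n + 1, w => by
    simp only [InHom, X.src_tgt, X.tgt_src]

theorem inHom_src {k n : ℕ} {a b : X.cell k} (hn : k < n) (w : X.cell (n + 1)) :
    X.InHom a b w ↔ X.InHom a b (X.src w) :=
  ⟨fun h => h.elim (fun ⟨h, _⟩ => absurd h hn.ne') id, Or.inr⟩

theorem Prec.inHom_iff {k : ℕ} {a b : X.cell k} {u v : X.Vertex} (h : X.Prec u v)
    (hu : k < u.1) (hv : k < v.1) : X.InHom a b u.2 ↔ X.InHom a b v.2 := by
  cases h with
  | src y => exact (inHom_src hu y).symm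
  | tgt x => exact (inHom_src hv x).trans (inHom_src_iff_tgt x)

theorem exists_inHom {k : ℕ} : ∀ {n : ℕ} (w : X.cell n), k < n →
    ∃ a b : X.cell k, X.InHom a b w
  | 0, _, h => absurd h (Nat.not_lt_zero _)
  | n + 1, w, h => by
    rcases (Nat.lt_succ_iff_lt_or_eq).1 h with h | rfl
    · obtain ⟨a, b, h'⟩ := exists_inHom (X.src w) h
      exact ⟨a, b, Or.inr h'⟩
    · exact ⟨_, _, inHom_base w⟩

theorem InHom.unique {k : ℕ} {a b a' b' : X.cell k} : ∀ {n : ℕ} {w : X.cell n},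
    X.InHom a b w → X.InHom a' b' w → a = a' ∧ b = b'
  | 0, _, h, _ => h.elim
  | n + 1, w, h, h' => by
    rcases Nat.lt_or_ge k n with hn | hn
    · exact InHom.unique ((inHom_src hn w).1 h) ((inHom_src hn w).1 h')
    · obtain rfl : n = k := le_antisymm hn (Nat.lt_succ_iff.1 h.lt)
      obtain ⟨rfl, rfl⟩ := h.base
      exact h'.base

theorem InHom.le_left {k : ℕ} {a b : X.cell k} : ∀ {n : ℕ} {w : X.cell n},
    X.InHom a b w → X.le ⟨k, a⟩ ⟨n, w⟩
  | 0, _, h => h.elim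
  | n + 1, w, h => by
    rcases Nat.lt_or_ge k n with hn | hn
    · exact (InHom.le_left ((inHom_src hn w).1 h)).tail (.src w)
    · obtain rfl : n = k := le_antisymm hn (Nat.lt_succ_iff.1 h.lt)
      obtain ⟨rfl, rfl⟩ := h.base
      exact .single (.src w)

theorem InHom.le_right {k : ℕ} {a b : X.cell k} : ∀ {n : ℕ} {w : X.cell n},
    X.InHom a b w → X.le ⟨n, w⟩ ⟨k, b⟩
  | 0, _, h => h.elim
  | n + 1, w, h => by
    rcases Nat.lt_or_ge k n with hn | hn
    · exact .head (.tgt w)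
        (InHom.le_right ((inHom_src_iff_tgt w).1 ((inHom_src hn w).1 h)))
    · obtain rfl : n = k := le_antisymm hn (Nat.lt_succ_iff.1 h.lt)
      obtain ⟨rfl, rfl⟩ := h.base
      exact .single (.tgt w)

theorem Prec.enter {k : ℕ} {a b : X.cell k} {u v : X.Vertex} (h : X.Prec u v)
    (hu : u.1 ≤ k) (hv : X.InHom a b v.2) : u = ⟨k, a⟩ := by
  cases h with
  | @src n y =>
    obtain rfl : n = k := le_antisymm hu (Nat.lt_succ_iff.1 hv.lt)
    rw [← hv.base.1]
  | @tgt n x => exact absurd hv.lt (by simp at hu ⊢; omega)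

theorem Prec.exit {k : ℕ} {a b : X.cell k} {u v : X.Vertex} (h : X.Prec u v)
    (hu : X.InHom a b u.2) (hv : v.1 ≤ k) : v = ⟨k, b⟩ := by
  cases h with
  | @tgt n y =>
    obtain rfl : n = k := le_antisymm hv (Nat.lt_succ_iff.1 hu.lt)
    rw [← hu.base.2]
  | @src n x => exact absurd hu.lt (by simp at hv ⊢; omega)

theorem le_of_inHom {k : ℕ} {a b : X.cell k} {u v : X.Vertex} (h : X.le u v)
    (hu : u.1 ≤ k) (hv : X.InHom a b v.2) : X.le u ⟨k, a⟩ := by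
  induction h with
  | refl => exact absurd hv.lt hu.not_gt
  | @tail v' v h h' ih =>
    rcases Nat.lt_or_ge k v'.1 with hk | hk
    · exact ih ((h'.inHom_iff hk hv.lt).2 hv)
    · rw [← h'.enter hk hv]; exact h

theorem inHom_le {k : ℕ} {a b : X.cell k} {u v : X.Vertex} (h : X.le u v)
    (hu : X.InHom a b u.2) (hv : v.1 ≤ k) : X.le ⟨k, b⟩ v := by
  induction h using Relation.ReflTransGen.head_induction_on with
  | refl => exact absurd hu.lt hv.not_gt
  | @head u u' h' h ih =>
    rcases Nat.lt_or_ge k u'.1 with hk | hk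
    · exact ih ((h'.inHom_iff hu.lt hk).1 hu)
    · rw [← h'.exit hu hk]; exact h

theorem IsCard.consec_of_inHom (hX : X.IsCard) {k n : ℕ} {a b : X.cell k} {w : X.cell n}
    (h : X.InHom a b w) : X.Consec a b := by
  refine ⟨?_, Set.ext fun z => ⟨fun ⟨h1, h2⟩ => ?_, ?_⟩⟩
  · rintro rfl
    have := congrArg Sigma.fst (hX.antisymm _ _ h.le_left h.le_right)
    exact absurd this h.lt.ne
  · rcases hX.total ⟨k, z⟩ ⟨n, w⟩ with h' | h'
    · have := hX.antisymm _ _ h1 (le_of_inHom h' le_rfl h)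
      simp at this; exact Or.inl this.symm
    · have := hX.antisymm _ _ h2 (inHom_le h' h le_rfl)
      simp at this; exact Or.inr this
  · have hab : X.le ⟨k, a⟩ ⟨k, b⟩ := h.le_left.trans h.le_right
    rintro (rfl | rfl)
    · exact ⟨.refl, hab⟩
    · exact ⟨hab, .refl⟩

theorem Consec.le {k : ℕ} {a b : X.cell k} (h : X.Consec a b) : X.le ⟨k, a⟩ ⟨k, b⟩ :=
  ((Set.ext_iff.1 h.2 a).2 (Or.inl rfl)).2

theorem Consec.eq_or {k : ℕ} {a b c : X.cell k} (h : X.Consec a b)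
    (h1 : X.le ⟨k, a⟩ ⟨k, c⟩) (h2 : X.le ⟨k, c⟩ ⟨k, b⟩) : c = a ∨ c = b :=
  (Set.ext_iff.1 h.2 c).1 ⟨h1, h2⟩

theorem IsCard.exists_of_consec (hX : X.IsCard) {a b : X.cell 0} (h : X.Consec a b) :
    ∃ w : X.cell 1, X.src w = a ∧ X.tgt w = b := by
  rcases Relation.ReflTransGen.cases_head h.le with h' | ⟨v, h1, h2⟩
  · simp at h'; exact absurd h' h.1
  · obtain ⟨w, rfl, hw⟩ : ∃ w : X.cell 1, X.src w = a ∧ v = ⟨1, w⟩ := by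
      generalize hu : (⟨0, a⟩ : X.Vertex) = u at h1
      cases h1 with
      | @src n y =>
        obtain rfl : 0 = n := congrArg Sigma.fst hu
        simp at hu
        exact ⟨y, hu.symm, rfl⟩
      | @tgt n x => exact absurd (congrArg Sigma.fst hu) (by simp)
    subst hw
    have h3 : X.le ⟨0, X.tgt w⟩ ⟨0, b⟩ := inHom_le h2 (inHom_base w) le_rfl
    refine ⟨w, rfl, ?_⟩
    rcases h.eq_or ((inHom_base w).le_left.trans (inHom_base w).le_right) h3 with h4 | h4
    · have h5 := (inHom_base w).le_right
      rw [h4] at h5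
      have := congrArg Sigma.fst (hX.antisymm _ _ (inHom_base w).le_left h5)
      simp at this
    · exact h4

theorem Hom.le_app (f : X ⟶ Y) {u v : X.Vertex} (h : X.le u v) :
    Y.le ⟨u.1, f.app u.2⟩ ⟨v.1, f.app v.2⟩ := by
  induction h with
  | refl => exact .refl
  | tail _ h ih =>
    refine ih.tail ?_
    cases h with
    | src y => simpa only [f.app_src] using Prec.src (f.app y)
    | tgt x => simpa only [f.app_tgt] using Prec.tgt (f.app x)

theorem Hom.inHom_app (f : X ⟶ Y) {k : ℕ} {a b : X.cell k} : ∀ {n : ℕ} {w : X.cell n},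
    X.InHom a b w → Y.InHom (f.app a) (f.app b) (f.app w)
  | 0, _, h => h.elim
  | n + 1, w, h => by
    rcases Nat.lt_or_ge k n with hn | hn
    · rw [inHom_src hn, ← f.app_src]
      exact Hom.inHom_app f ((inHom_src hn w).1 h)
    · obtain rfl : n = k := le_antisymm hn (Nat.lt_succ_iff.1 h.lt)
      obtain ⟨rfl, rfl⟩ := h.base
      rw [f.app_src, f.app_tgt]
      exact inHom_base _

theorem Hom.consec_app (f : X ⟶ Y) (hX : X.IsCard) (hY : Y.IsCard) {a b : X.cell 0}
    (h : X.Consec a b) : Y.Consec (f.app a) (f.app b) := by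
  obtain ⟨w, rfl, rfl⟩ := hX.exists_of_consec h
  exact hY.consec_of_inHom (Hom.inHom_app f (inHom_base w))

theorem IsCard.mem_restrSub (hX : X.IsCard) {a b : X.cell 0} {n : ℕ} {w : X.cell (n + 1)} :
    w ∈ (X.restrSub a b).mem n ↔ X.InHom a b w := by
  constructor
  · rintro ⟨S, ⟨hc, hS⟩, hw⟩
    obtain ⟨h1, h2⟩ := hS n w hw
    obtain ⟨a', b', h⟩ := exists_inHom w (Nat.succ_pos n)
    have ha := hc.eq_or (le_of_inHom h1 le_rfl h) (h.le_left.trans h2)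
    have hb := hc.eq_or (h1.trans h.le_right) (inHom_le h2 h le_rfl)
    rcases ha with rfl | rfl
    · rcases hb with rfl | rfl
      · have := congrArg Sigma.fst (hX.antisymm _ _ h1 h.le_right)
        simp at this
      · exact h
    · have := congrArg Sigma.fst (hX.antisymm _ _ h2 h.le_left)
      simp at this
  · intro h
    refine ⟨⟨fun n => {w : X.cell (n + 1) | X.InHom a b w}, ?_, ?_⟩,
      ⟨hX.consec_of_inHom h, fun n x hx => ⟨InHom.le_left hx, InHom.le_right hx⟩⟩, h⟩
    · intro n x hx
      exact (inHom_src (Nat.succ_pos _) x).1 hx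
    · intro n x hx
      exact (inHom_src_iff_tgt (X := X) x).1 ((inHom_src (X := X) (Nat.succ_pos _) x).1 hx)

theorem IsCard.mem_compSub (hX : X.IsCard) {k : ℕ} {a b : X.cell k} (hab : X.Consec a b)
    {w : X.cell (k + 1)} :
    w ∈ (X.compSub a b).mem (k + 1) ↔ X.src w = a ∧ X.tgt w = b := by
  constructor
  · rintro ⟨S, hS, hw⟩
    have hS : S.mem k = {a, b} := hS
    have h1 : X.src w ∈ ({a, b} : Set (X.cell k)) := hS ▸ S.src_mem hw
    have h2 : X.tgt w ∈ ({a, b} : Set (X.cell k)) := hS ▸ S.tgt_mem hw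
    have hc := hX.consec_of_inHom (inHom_base w)
    rcases h1 with h1 | h1 <;> rcases h2 with h2 | h2
    · exact absurd (h1.trans h2.symm) hc.1
    · exact ⟨h1, h2⟩
    · have := hc.le
      rw [h1, h2] at this
      have := hX.antisymm _ _ this hab.le
      simp at this
      exact absurd this.symm hab.1
    · exact absurd (h1.trans h2.symm) hc.1
  · rintro ⟨rfl, rfl⟩
    refine ⟨⟨fun n => {v | n < k ∨ (∃ h : n = k, v = cast (by rw [h]) (X.src w) ∨
      v = cast (by rw [h]) (X.tgt w)) ∨ X.InHom (X.src w) (X.tgt w) v}, ?_, ?_⟩, ?_, ?_⟩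
    · rintro n x (h | ⟨rfl, h⟩ | h)
      · exact Or.inl (by omega)
      · exact Or.inl (by omega)
      · rcases Nat.lt_or_ge k n with hn | hn
        · exact Or.inr (Or.inr ((inHom_src hn x).1 h))
        · obtain rfl : n = k := le_antisymm hn (Nat.lt_succ_iff.1 h.lt)
          exact Or.inr (Or.inl ⟨rfl, Or.inl h.base.1⟩)
    · rintro n x (h | ⟨rfl, h⟩ | h)
      · exact Or.inl (by omega)
      · exact Or.inl (by omega)
      · rcases Nat.lt_or_ge k n with hn | hn
        · exact Or.inr (Or.inr ((inHom_src_iff_tgt x).1 ((inHom_src hn x).1 h)))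
        · obtain rfl : n = k := le_antisymm hn (Nat.lt_succ_iff.1 h.lt)
          exact Or.inr (Or.inl ⟨rfl, Or.inr h.base.2⟩)
    · ext v
      constructor
      · rintro (h | ⟨_, h⟩ | h)
        · exact absurd h (lt_irrefl _)
        · exact h
        · exact absurd h.lt (lt_irrefl _)
      · exact fun h => Or.inr (Or.inl ⟨rfl, h⟩)
    · exact Or.inr (Or.inr (inHom_base w))

theorem Sub.le_incl {S : X.Sub} {u v : S.toGlobSet.Vertex} (h : S.toGlobSet.le u v) :
    X.le ⟨u.1, u.2.1⟩ ⟨v.1, v.2.1⟩ := Hom.le_app S.incl h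

theorem Sub.isCard_of_total (hX : X.IsCard) (S : X.Sub)
    (h : ∀ u v : S.toGlobSet.Vertex, X.le ⟨u.1, u.2.1⟩ ⟨v.1, v.2.1⟩ → S.toGlobSet.le u v) :
    S.toGlobSet.IsCard where
  finite := by
    have := hX.finite
    refine Finite.of_injective (fun u : S.toGlobSet.Vertex => (⟨u.1, u.2.1⟩ : X.Vertex)) ?_
    rintro ⟨n, x, hx⟩ ⟨m, y, hy⟩ h
    obtain rfl : n = m := congrArg Sigma.fst h
    simp at h
    subst h
    rfl
  antisymm := by
    rintro ⟨n, x, hx⟩ ⟨m, y, hy⟩ h1 h2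
    have h := hX.antisymm _ _ (Sub.le_incl h1) (Sub.le_incl h2)
    obtain rfl : n = m := congrArg Sigma.fst h
    simp at h
    subst h
    rfl
  total u v := (hX.total _ _).imp (h u v) (h v u)

theorem IsCard.restr (hX : X.IsCard) (a b : X.cell 0) :
    (X.restrSub a b).toGlobSet.IsCard := by
  have hle : ∀ u v : (X.restrSub a b).toGlobSet.Vertex, (X.restrSub a b).toGlobSet.le u v →
      X.le ⟨u.1 + 1, u.2.1⟩ ⟨v.1 + 1, v.2.1⟩ := by
    intro u v h
    induction h with
    | refl => exact .refl
    | tail _ h ih =>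
      refine ih.tail ?_
      cases h with
      | src y => exact Prec.src (X := X) (n := _ + 1) y.1
      | tgt y => exact Prec.tgt (X := X) (n := _ + 1) y.1
  have hinj : ∀ u v : (X.restrSub a b).toGlobSet.Vertex,
      (⟨u.1 + 1, u.2.1⟩ : X.Vertex) = ⟨v.1 + 1, v.2.1⟩ → u = v := by
    rintro ⟨n, x, hx⟩ ⟨m, y, hy⟩ h
    obtain rfl : n = m := by simpa using congrArg Sigma.fst h
    obtain rfl : x = y := eq_of_heq (Sigma.mk.inj h).2
    rfl
  have key : ∀ (u : (X.restrSub a b).toGlobSet.Vertex) (v' : X.Vertex),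
      X.le ⟨u.1 + 1, u.2.1⟩ v' → ∀ v : (X.restrSub a b).toGlobSet.Vertex,
      v' = ⟨v.1 + 1, v.2.1⟩ → (X.restrSub a b).toGlobSet.le u v := by
    intro u v' h
    induction h with
    | refl => intro v hv; rw [hinj _ _ hv]; exact .refl
    | @tail v'' v' h1 h2 ih =>
      rintro ⟨m, w, hw⟩ rfl
      have hw' := hX.mem_restrSub.1 hw
      have hu' := hX.mem_restrSub.1 u.2.2
      obtain ⟨j, c⟩ := v''
      rcases j with _ | j
      · have h3 := h2.enter le_rfl hw'
        rw [h3] at h1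
        have := congrArg Sigma.fst (hX.antisymm _ _ h1 hu'.le_left)
        simp at this
      · have hc : X.InHom a b c := (h2.inHom_iff (Nat.succ_pos _) (Nat.succ_pos _)).2 hw'
        refine (ih ⟨j, c, hX.mem_restrSub.2 hc⟩ rfl).tail ?_
        clear ih h1
        generalize hp : (⟨j + 1, c⟩ : X.Vertex) = p at h2
        generalize hq : (⟨m + 1, w⟩ : X.Vertex) = q at h2
        cases h2 with
        | @src n y =>
          obtain rfl : j + 1 = n := congrArg Sigma.fst hp
          obtain rfl : m = j + 1 := by simpa using congrArg Sigma.fst hq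
          obtain rfl : w = y := eq_of_heq (Sigma.mk.inj hq).2
          obtain rfl : c = X.src w := eq_of_heq (Sigma.mk.inj hp).2
          exact Prec.src (X := (X.restrSub a b).toGlobSet) ⟨w, hw⟩
        | @tgt n y =>
          obtain rfl : m + 1 = n := congrArg Sigma.fst hq
          obtain rfl : j = m + 1 := by simpa using congrArg Sigma.fst hp
          obtain rfl : c = y := eq_of_heq (Sigma.mk.inj hp).2
          obtain rfl : w = X.tgt c := eq_of_heq (Sigma.mk.inj hq).2
          exact Prec.tgt (X := (X.restrSub a b).toGlobSet) ⟨c, hX.mem_restrSub.2 hc⟩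
  refine ⟨?_, fun u v h1 h2 => hinj _ _ (hX.antisymm _ _ (hle _ _ h1) (hle _ _ h2)),
    fun u v => (hX.total _ _).imp (fun h => key u _ h v rfl) (fun h => key v _ h u rfl)⟩
  have := hX.finite
  exact Finite.of_injective _ (fun u v => hinj u v)

theorem DimLE.restr {n : ℕ} (h : X.DimLE (n + 1)) (a b : X.cell 0) :
    (X.restrSub a b).toGlobSet.DimLE n := fun m hm =>
  ⟨fun x => (h (m + 1) (by omega)).false x.1⟩

theorem nonempty_cell_zero : ∀ {n : ℕ}, X.cell n → Nonempty (X.cell 0)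
  | 0, x => ⟨x⟩
  | _ + 1, x => nonempty_cell_zero (X.src x)

theorem IsCard.exists_extremal (hX : X.IsCard) (ε : Bool) {ι : Type*} [Finite ι] [Nonempty ι]
    (f : ι → X.Vertex) : ∃ i, ∀ j, X.ord ε (f i) (f j) := by
  let r : X.Vertex → X.Vertex → Prop := fun x y => X.ord ε y x
  have : IsTrans X.Vertex r := ⟨fun x y z h1 h2 => by
    cases ε
    · exact Relation.ReflTransGen.trans (r := X.Prec) h2 h1
    · exact Relation.ReflTransGen.trans (r := X.Prec) h1 h2⟩
  have hd : Directed r f := fun i j => by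
    have ht : r (f i) (f j) ∨ r (f j) (f i) := by
      cases ε
      · exact (hX.total _ _).symm
      · exact hX.total _ _
    have hr : ∀ x, r x x := fun x => by cases ε <;> exact Relation.ReflTransGen.refl
    rcases ht with h | h
    · exact ⟨j, h, hr _⟩
    · exact ⟨i, hr _, h⟩
  exact hd.finite_le id

theorem IsCard.ord_antisymm (hX : X.IsCard) {ε : Bool} {x y : X.Vertex} (h1 : X.ord ε x y)
    (h2 : X.ord ε y x) : x = y := by
  cases ε
  · exact hX.antisymm _ _ h1 h2
  · exact hX.antisymm _ _ h2 h1

theorem IsCard.dim_eq_zero (hX : X.IsCard) {ε : Bool} {x : X.Vertex}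
    (h : ∀ w, X.ord ε x w) : x.1 = 0 := by
  obtain ⟨n, x⟩ := x
  rcases n with _ | n
  · rfl
  · cases ε
    · have := congrArg Sigma.fst (hX.antisymm _ _ (.single (.src x)) (h ⟨n, X.src x⟩))
      simp at this
    · have := congrArg Sigma.fst (hX.antisymm _ _ (.single (.tgt x)) (h ⟨n, X.tgt x⟩))
      simp at this

theorem subset_smallest {B : Set X.Vertex} {v : X.Vertex} (h : v ∈ B) :
    v.2 ∈ (Sub.smallest B).mem v.1 := fun _ hS => hS v h

/-- The vertices of `bdry ε (k+1)`. -/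
theorem IsCard.mem_bdry_succ (hX : X.IsCard) {ε : Bool} {k : ℕ} (v : X.Vertex) :
    v.2 ∈ (X.bdry ε (k + 1)).mem v.1 ↔ v.1 ≤ k ∨ ∃ x : X.cell (k + 1), v = ⟨k + 1, x⟩ ∧
      ∀ x' : X.cell (k + 1), X.src x' = X.src x → X.tgt x' = X.tgt x →
        X.ord ε ⟨k + 1, x⟩ ⟨k + 1, x'⟩ := by
  constructor
  · intro h
    let T : X.Sub :=
      { mem := fun n => {w | n ≤ k ∨ ∃ x : X.cell (k + 1), (⟨n, w⟩ : X.Vertex) = ⟨k + 1, x⟩ ∧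
          ∀ x' : X.cell (k + 1), X.src x' = X.src x → X.tgt x' = X.tgt x →
          X.ord ε ⟨k + 1, x⟩ ⟨k + 1, x'⟩}
        src_mem := by
          rintro n x (h | ⟨y, h, _⟩)
          · exact Or.inl (by omega)
          · exact Or.inl (by have := congrArg Sigma.fst h; simp at this; omega)
        tgt_mem := by
          rintro n x (h | ⟨y, h, _⟩)
          · exact Or.inl (by omega)
          · exact Or.inl (by have := congrArg Sigma.fst h; simp at this; omega) }
    refine h T ?_
    rintro v (h | ⟨x, y, z, rfl, hc, hx, hx'⟩)
    · exact Or.inl h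
    · refine Or.inr ⟨x, rfl, fun x' h1 h2 => hx' x' ?_⟩
      obtain ⟨rfl, rfl⟩ := (hX.mem_compSub hc).1 hx
      exact (hX.mem_compSub hc).2 ⟨h1, h2⟩
  · intro h
    apply subset_smallest
    rcases h with h | ⟨x, rfl, h⟩
    · exact Or.inl h
    · have hc := hX.consec_of_inHom (inHom_base x)
      refine Or.inr ⟨x, X.src x, X.tgt x, rfl, hc, (hX.mem_compSub hc).2 ⟨rfl, rfl⟩,
        fun x' hx' => ?_⟩
      obtain ⟨h1, h2⟩ := (hX.mem_compSub hc).1 hx'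
      exact h x' h1 h2

theorem IsCard.bdry (hX : X.IsCard) (ε : Bool) (m : ℕ) :
    (X.bdry ε m).toGlobSet.IsCard := by
  rcases m with _ | k
  · refine Sub.isCard_of_total hX _ ?_
    have key : ∀ {n : ℕ} {x : X.cell n}, x ∈ (X.bdry ε 0).mem n →
        ∀ w, X.ord ε ⟨n, x⟩ w := by
      intro n x hx
      let T : X.Sub :=
        { mem := fun n => {x | ∀ w, X.ord ε ⟨n, x⟩ w}
          src_mem := fun {n x} h => absurd (hX.dim_eq_zero h) (by simp)
          tgt_mem := fun {n x} h => absurd (hX.dim_eq_zero h) (by simp) }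
      exact hx T (fun v hv => hv)
    rintro ⟨n, x, hx⟩ ⟨m, y, hy⟩ _
    have h := hX.ord_antisymm (key hx ⟨m, y⟩) (key hy ⟨n, x⟩)
    obtain rfl : n = m := congrArg Sigma.fst h
    simp at h
    subst h
    exact .refl
  · refine Sub.isCard_of_total hX _ ?_
    let S := X.bdry ε (k + 1)
    let E : X.cell (k + 1) → Prop := fun x => ∀ x' : X.cell (k + 1), X.src x' = X.src x →
      X.tgt x' = X.tgt x → X.ord ε ⟨k + 1, x⟩ ⟨k + 1, x'⟩
    let R : X.Vertex → S.toGlobSet.Vertex → Prop := fun u u' =>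
      (u.1 ≤ k ∧ u = ⟨u'.1, u'.2.1⟩) ∨ ∃ x : X.cell (k + 1),
        X.InHom (X.src x) (X.tgt x) u.2 ∧ E x ∧ (⟨u'.1, u'.2.1⟩ : X.Vertex) = ⟨k + 1, x⟩
    have hinj : ∀ u v : S.toGlobSet.Vertex,
        (⟨u.1, u.2.1⟩ : X.Vertex) = ⟨v.1, v.2.1⟩ → u = v := by
      rintro ⟨n, x, hx⟩ ⟨m, y, hy⟩ h
      obtain rfl : n = m := congrArg Sigma.fst h
      simp at h
      subst h
      rfl
    have hE : ∀ x y : X.cell (k + 1), E x → E y → X.src x = X.src y → X.tgt x = X.tgt y →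
        (⟨k + 1, x⟩ : X.Vertex) = ⟨k + 1, y⟩ := fun x y hx hy h1 h2 =>
      hX.ord_antisymm (hx y h1.symm h2.symm) (hy x h1 h2)
    have hself : ∀ u : S.toGlobSet.Vertex, R ⟨u.1, u.2.1⟩ u := by
      rintro ⟨n, x, hx⟩
      rcases (hX.mem_bdry_succ ⟨n, x⟩).1 hx with h | ⟨y, h, hy⟩
      · exact Or.inl ⟨h, rfl⟩
      · obtain rfl : n = k + 1 := congrArg Sigma.fst h
        simp at h
        subst h
        exact Or.inr ⟨x, inHom_base x, hy, rfl⟩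
    have hex : ∀ u, ∃ u', R u u' := by
      intro u
      rcases Nat.lt_or_ge k u.1 with hk | hk
      · obtain ⟨a, b, h⟩ := exists_inHom u.2 hk
        have hw : ∃ w : X.cell (k + 1), X.src w = a ∧ X.tgt w = b := by
          clear hk
          obtain ⟨n, w⟩ := u
          induction n with
          | zero => exact h.elim
          | succ n ih =>
            rcases h with ⟨rfl, h⟩ | h
            · exact ⟨w, h⟩
            · exact ih _ h
        obtain ⟨w, hw⟩ := hw
        have := hX.finite
        let ι := {w : X.cell (k + 1) // X.src w = a ∧ X.tgt w = b}
        have : Finite ι := Finite.of_injective (fun i : ι => (⟨k + 1, i.1⟩ : X.Vertex))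
          (fun i j h => Subtype.ext (by simpa using h))
        have : Nonempty ι := ⟨⟨w, hw⟩⟩
        obtain ⟨⟨x, rfl, rfl⟩, hx⟩ :=
          hX.exists_extremal ε (fun i : ι => (⟨k + 1, i.1⟩ : X.Vertex))
        have hxE : E x := fun x' h1 h2 => hx ⟨x', h1, h2⟩
        exact ⟨⟨k + 1, x, (hX.mem_bdry_succ ⟨k + 1, x⟩).2 (Or.inr ⟨x, rfl, hxE⟩)⟩,
          Or.inr ⟨x, h, hxE, rfl⟩⟩
      · exact ⟨⟨u.1, u.2, (hX.mem_bdry_succ u).2 (Or.inl hk)⟩, Or.inl ⟨hk, rfl⟩⟩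
    have hfun : ∀ u u' u'', R u u' → R u u'' → u' = u'' := by
      rintro u u' u'' (⟨h1, h2⟩ | ⟨x, h1, h2, h3⟩) (⟨h1', h2'⟩ | ⟨x', h1', h2', h3'⟩)
      · exact hinj _ _ (h2.symm.trans h2')
      · exact absurd h1'.lt (by omega)
      · exact absurd h1.lt (by omega)
      · obtain ⟨ha, hb⟩ := h1.unique h1'
        exact hinj _ _ (h3.trans ((hE _ _ h2 h2' ha hb).trans h3'.symm))
    have hstep : ∀ u v u' v', X.Prec u v → R u u' → R v v' → S.toGlobSet.le u' v' := by
      rintro u v u' v' h (⟨h1, h2⟩ | ⟨x, h1, h2, h3⟩) (⟨h1', h2'⟩ | ⟨x', h1', h2', h3'⟩)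
      · obtain ⟨i, y, hy⟩ := u'
        obtain ⟨j, z, hz⟩ := v'
        dsimp only at h2 h2'
        cases h with
        | src p =>
          obtain rfl := congrArg Sigma.fst h2
          obtain rfl := congrArg Sigma.fst h2'
          simp at h2 h2'
          subst h2'
          subst h2
          exact .single (Prec.src (X := S.toGlobSet) ⟨p, hz⟩)
        | tgt p =>
          obtain rfl := congrArg Sigma.fst h2
          obtain rfl := congrArg Sigma.fst h2'
          simp at h2 h2'
          subst h2
          subst h2'
          exact .single (Prec.tgt (X := S.toGlobSet) ⟨p, hy⟩)
      · have h4 := h.enter h1 h1'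
        obtain ⟨i, y, hy⟩ := u'
        obtain ⟨j, z, hz⟩ := v'
        have h2 := h2.symm.trans h4
        obtain rfl : i = k := congrArg Sigma.fst h2
        obtain rfl : j = i + 1 := congrArg Sigma.fst h3'
        simp at h2 h3'
        subst h3'
        subst h2
        exact .single (Prec.src (X := S.toGlobSet) ⟨z, hz⟩)
      · have h4 := h.exit h1 h1'
        obtain ⟨i, y, hy⟩ := u'
        obtain ⟨j, z, hz⟩ := v'
        have h2' := h2'.symm.trans h4
        obtain rfl : j = k := congrArg Sigma.fst h2'
        obtain rfl : i = j + 1 := congrArg Sigma.fst h3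
        simp at h2' h3
        subst h3
        subst h2'
        exact .single (Prec.tgt (X := S.toGlobSet) ⟨y, hy⟩)
      · have h4 : X.InHom (X.src x') (X.tgt x') u.2 := (h.inHom_iff h1.lt h1'.lt).2 h1'
        rw [hfun u u' v' (Or.inr ⟨x, h1, h2, h3⟩) (Or.inr ⟨x', h4, h2', h3'⟩)]
        exact .refl
    have key : ∀ u v, X.le u v → ∀ u' v', R u u' → R v v' → S.toGlobSet.le u' v' := by
      intro u v h
      induction h with
      | refl => intro u' v' h1 h2; rw [hfun _ _ _ h1 h2]; exact .refl
      | @tail v v₁ _ h ih =>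
        intro u' v' h1 h2
        obtain ⟨v'', hv⟩ := hex v
        exact (ih u' v'' h1 hv).trans (hstep _ _ _ _ h hv h2)
    exact fun u v h => key _ _ h u v (hself u) (hself v)

theorem IsCard.bdry_nonempty (hX : X.IsCard) (ε : Bool) (m : ℕ) (h : Nonempty (X.cell 0)) :
    Nonempty ((X.bdry ε m).toGlobSet.cell 0) := by
  obtain ⟨x⟩ := h
  rcases m with _ | k
  · have := hX.finite
    have : Nonempty X.Vertex := ⟨⟨0, x⟩⟩
    obtain ⟨v, hv⟩ := hX.exists_extremal ε (id : X.Vertex → X.Vertex)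
    exact nonempty_cell_zero (X := (X.bdry ε 0).toGlobSet) (n := v.1)
      ⟨v.2, subset_smallest (B := X.bdryGen ε 0) hv⟩
  · exact ⟨⟨x, subset_smallest (B := X.bdryGen ε (k + 1)) (v := ⟨0, x⟩)
      (Or.inl (Nat.zero_le k))⟩⟩

end Facts

end GlobSet

namespace GlobSet

section IsoFacts

variable {X Y : GlobSet.{u}}

/-- The preimage of a subfunctor. -/
def Sub.comap (f : X ⟶ Y) (S : Y.Sub) : X.Sub where
  mem n := {x | f.app x ∈ S.mem n}
  src_mem {n x} h := by
    have := S.src_mem h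
    rwa [← f.app_src] at this
  tgt_mem {n x} h := by
    have := S.tgt_mem h
    rwa [← f.app_tgt] at this

/-- The morphism between subfunctors that a morphism induces. -/
def Hom.restrict (f : X ⟶ Y) (S : X.Sub) (T : Y.Sub)
    (h : ∀ {n : ℕ} (x : X.cell n), x ∈ S.mem n → f.app x ∈ T.mem n) :
    S.toGlobSet ⟶ T.toGlobSet where
  app x := ⟨f.app x.1, h x.1 x.2⟩
  app_src x := Subtype.ext (f.app_src x.1)
  app_tgt x := Subtype.ext (f.app_tgt x.1)

/-- The shift of a morphism. -/
def Hom.shift (f : X ⟶ Y) : X.shift ⟶ Y.shift where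
  app x := f.app x
  app_src x := f.app_src x
  app_tgt x := f.app_tgt x

theorem hom_ext {f g : X ⟶ Y} (h : ∀ (n : ℕ) (x : X.cell n), f.app x = g.app x) : f = g :=
  Hom.ext (funext fun n => funext fun x => h n x)

theorem inv_app (e : X ≅ Y) {n : ℕ} (x : X.cell n) : e.inv.app (e.hom.app x) = x :=
  congrArg (fun f : X ⟶ X => f.app x) e.hom_inv_id

theorem hom_app (e : X ≅ Y) {n : ℕ} (y : Y.cell n) : e.hom.app (e.inv.app y) = y :=
  congrArg (fun f : Y ⟶ Y => f.app y) e.inv_hom_id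

theorem iso_le (e : X ≅ Y) {n m : ℕ} {x : X.cell n} {y : X.cell m} :
    Y.le ⟨n, e.hom.app x⟩ ⟨m, e.hom.app y⟩ ↔ X.le ⟨n, x⟩ ⟨m, y⟩ :=
  ⟨fun h => by simpa only [inv_app] using Hom.le_app e.inv h, fun h => Hom.le_app e.hom h⟩

theorem iso_ord (e : X ≅ Y) {ε : Bool} {n m : ℕ} {x : X.cell n} {y : X.cell m} :
    Y.ord ε ⟨n, e.hom.app x⟩ ⟨m, e.hom.app y⟩ ↔ X.ord ε ⟨n, x⟩ ⟨m, y⟩ := by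
  cases ε
  · exact iso_le e
  · exact iso_le e

theorem iso_consec (e : X ≅ Y) {k : ℕ} {a b : X.cell k} (h : X.Consec a b) :
    Y.Consec (e.hom.app a) (e.hom.app b) := by
  refine ⟨fun h' => h.1 (by rw [← inv_app e a, h', inv_app]), Set.ext fun z => ?_⟩
  obtain ⟨z, rfl⟩ : ∃ x, e.hom.app x = z := ⟨_, hom_app e z⟩
  have hz := Set.ext_iff.1 h.2 z
  have hi : ∀ c : X.cell k, e.hom.app z = e.hom.app c ↔ z = c := fun c =>
    ⟨fun h => by rw [← inv_app e z, h, inv_app], fun h => by rw [h]⟩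
  simp only [Set.mem_ofPred_eq, Set.mem_insert_iff, Set.mem_singleton_iff, iso_le, hi] at hz ⊢
  exact hz

theorem iso_compSub (e : X ≅ Y) {k n : ℕ} {a b : X.cell k} {x : X.cell n}
    (h : x ∈ (X.compSub a b).mem n) :
    e.hom.app x ∈ (Y.compSub (e.hom.app a) (e.hom.app b)).mem n := by
  obtain ⟨S, hS, hx⟩ := h
  have hS : S.mem k = {a, b} := hS
  refine ⟨S.comap e.inv, ?_, by simpa only [Sub.comap, Set.mem_ofPred_eq, inv_app] using hx⟩
  ext z
  obtain ⟨z, rfl⟩ : ∃ x, e.hom.app x = z := ⟨_, hom_app e z⟩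
  have hi : ∀ c : X.cell k, e.hom.app z = e.hom.app c ↔ z = c := fun c =>
    ⟨fun h => by rw [← inv_app e z, h, inv_app], fun h => by rw [h]⟩
  simp only [Sub.comap, Set.mem_ofPred_eq, inv_app, hS, Set.mem_insert_iff,
    Set.mem_singleton_iff, hi]

theorem iso_bdryGen (e : X ≅ Y) {ε : Bool} {m : ℕ} {v : X.Vertex} (h : v ∈ X.bdryGen ε m) :
    (⟨v.1, e.hom.app v.2⟩ : Y.Vertex) ∈ Y.bdryGen ε m := by
  rcases m with _ | k
  · rintro ⟨n, w⟩
    obtain ⟨w, rfl⟩ : ∃ x, e.hom.app x = w := ⟨_, hom_app e w⟩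
    exact (iso_ord e).2 (h ⟨n, w⟩)
  · rcases h with h | ⟨x, y, z, rfl, hc, hx, hx'⟩
    · exact Or.inl h
    · refine Or.inr ⟨e.hom.app x, e.hom.app y, e.hom.app z, rfl, iso_consec e hc,
        iso_compSub e hx, fun w hw => ?_⟩
      have := iso_compSub e.symm hw
      simp only [Iso.symm_hom, inv_app] at this
      have := (iso_ord e).2 (hx' _ this)
      rwa [hom_app] at this

theorem iso_bdry (e : X ≅ Y) {ε : Bool} {m n : ℕ} {x : X.cell n}
    (h : x ∈ (X.bdry ε m).mem n) : e.hom.app x ∈ (Y.bdry ε m).mem n :=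
  fun S hS => h (S.comap e.hom) fun _ hv => hS _ (iso_bdryGen e hv)

/-- An isomorphism restricts to the boundaries. -/
def bdryIso (e : X ≅ Y) (ε : Bool) (m : ℕ) :
    (X.bdry ε m).toGlobSet ≅ (Y.bdry ε m).toGlobSet where
  hom := Hom.restrict e.hom _ _ fun _ h => iso_bdry e h
  inv := Hom.restrict e.inv _ _ fun _ h => iso_bdry e.symm h
  hom_inv_id := hom_ext fun _ x => Subtype.ext (inv_app e x.1)
  inv_hom_id := hom_ext fun _ x => Subtype.ext (hom_app e x.1)

end IsoFacts

end GlobSet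

/-! ## Globular cardinals -/

/-- A globular cardinal. -/
structure GlobCard extends GlobSet.{u} where
  isCard : toGlobSet.IsCard

namespace GlobCard

/-- The restriction `X(y,z)` for consecutive `0`-vertices `y`, `z`
(and the empty globular cardinal if `y`, `z` are not consecutive). -/
def restr (X : GlobCard.{u}) (y z : X.cell 0) : GlobCard.{u} :=
  ⟨(X.restrSub y z).toGlobSet, X.isCard.restr y z⟩

/-- The restriction `f(y,z) : X(y,z) ⟶ Y(f y, f z)` of a morphism `f : X ⟶ Y`. -/
def restrHom {X Y : GlobCard.{u}} (f : X.toGlobSet ⟶ Y.toGlobSet) (y z : X.cell 0) :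
    (X.restr y z).toGlobSet ⟶ (Y.restr (f.app y) (f.app z)).toGlobSet :=
  GlobSet.Hom.restrict (GlobSet.Hom.shift f) _ _ fun _ h =>
    Y.isCard.mem_restrSub.2 (GlobSet.Hom.inHom_app f (X.isCard.mem_restrSub.1 h))

/-- The dimension of a globular cardinal (`0` for the empty one, whose dimension is
usually taken to be `-1`). -/
noncomputable def dim (X : GlobCard.{u}) : ℕ := sInf {n | X.DimLE n}

theorem dimLE_dim (X : GlobCard.{u}) : X.DimLE X.dim := by
  refine Nat.sInf_mem (s := {n | X.DimLE n}) ?_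
  have := X.isCard.finite
  obtain ⟨N, hN⟩ := (Set.finite_range (fun v : X.Vertex => v.1)).bddAbove
  exact ⟨N, fun m hm => ⟨fun x => absurd (hN ⟨⟨m, x⟩, rfl⟩) hm.not_ge⟩⟩

/-- The linear order on the `0`-vertices. -/
noncomputable abbrev vertexOrder (X : GlobCard.{u}) : LinearOrder (X.cell 0) where
  le a b := X.le ⟨0, a⟩ ⟨0, b⟩
  le_refl _ := Relation.ReflTransGen.refl
  le_trans _ _ _ h1 h2 := Relation.ReflTransGen.trans (r := X.Prec) h1 h2
  le_antisymm a b h1 h2 := by simpa using X.isCard.antisymm _ _ h1 h2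
  le_total _ _ := X.isCard.total _ _
  toDecidableLE := Classical.decRel _

instance finite_cell (X : GlobCard.{u}) (n : ℕ) : Finite (X.cell n) :=
  have := X.isCard.finite
  Finite.of_injective (fun x : X.cell n => (⟨n, x⟩ : X.Vertex)) fun x y h => by simpa using h

theorem consec_iff_covBy (X : GlobCard.{u}) {a b : X.cell 0} :
    X.Consec a b ↔ @CovBy _ X.vertexOrder.toLT a b := by
  letI := X.vertexOrder
  constructor
  · intro h
    refine ⟨lt_of_le_of_ne h.le h.1, fun c h1 h2 => ?_⟩
    rcases h.eq_or (c := c) h1.le h2.le with rfl | rfl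
    · exact lt_irrefl _ h1
    · exact lt_irrefl _ h2
  · intro h
    refine ⟨h.lt.ne, Set.ext fun c => ⟨fun hc => ?_, ?_⟩⟩
    · exact CovBy.eq_or_eq h (show a ≤ c from hc.1) (show c ≤ b from hc.2)
    · have hab : X.le ⟨0, a⟩ ⟨0, b⟩ := h.le
      rintro (rfl | rfl)
      · exact ⟨.refl, hab⟩
      · exact ⟨hab, .refl⟩

/-- The list `y₀, y₁, …, y_p` of the `0`-vertices in increasing order. -/
noncomputable def vertexList (X : GlobCard.{u}) : List (X.cell 0) :=
  letI := X.vertexOrder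
  letI := Fintype.ofFinite (X.cell 0)
  (Finset.univ : Finset (X.cell 0)).sort

theorem mem_vertexList (X : GlobCard.{u}) (a : X.cell 0) : a ∈ X.vertexList := by
  simp [vertexList]

theorem pairwise_vertexList (X : GlobCard.{u}) :
    X.vertexList.Pairwise (fun a b => X.le ⟨0, a⟩ ⟨0, b⟩ ∧ a ≠ b) := by
  letI := X.vertexOrder
  letI := Fintype.ofFinite (X.cell 0)
  have := (Finset.sortedLT_sort (Finset.univ : Finset (X.cell 0))).pairwise
  exact this.imp fun h => ⟨h.le, h.ne⟩

theorem vertexList_ne_nil (X : GlobCard.{u}) (h : Nonempty (X.cell 0)) : X.vertexList ≠ [] :=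
  List.ne_nil_of_mem (X.mem_vertexList h.some)

theorem isChain_of_pairwise (X : GlobCard.{u}) (pre : List (X.cell 0)) :
    ∀ l : List (X.cell 0),
      (pre ++ l).Pairwise (fun a b => X.le ⟨0, a⟩ ⟨0, b⟩ ∧ a ≠ b) →
      (∀ a, a ∈ pre ++ l) → l.IsChain (fun a b => X.Consec a b)
  | [], _, _ => .nil
  | [_], _, _ => .singleton _
  | a :: b :: l, hp, hm => by
    refine List.IsChain.cons_cons ?_ (isChain_of_pairwise X (pre ++ [a]) (b :: l)
      (by simpa using hp) (by simpa using hm))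
    letI := X.vertexOrder
    have hp' : (pre ++ a :: b :: l).Pairwise (fun a b => a < b) :=
      hp.imp fun h => lt_of_le_of_ne h.1 h.2
    rw [consec_iff_covBy]
    rw [List.pairwise_append] at hp'
    obtain ⟨-, h2, h3⟩ := hp'
    rw [List.pairwise_cons, List.pairwise_cons] at h2
    refine ⟨h2.1 b (by simp), fun c hac hcb => ?_⟩
    have hc := hm c
    simp only [List.mem_append, List.mem_cons] at hc
    rcases hc with hc | rfl | rfl | hc
    · exact lt_asymm hac (h3 c hc a (by simp))
    · exact lt_irrefl _ hac
    · exact lt_irrefl _ hcb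
    · exact lt_asymm hcb (h2.2.1 c hc)

theorem isChain_vertexList (X : GlobCard.{u}) :
    X.vertexList.IsChain (fun a b => X.Consec a b) :=
  X.isChain_of_pairwise [] _ X.pairwise_vertexList X.mem_vertexList

theorem map_vertexList {X Y : GlobCard.{u}} (e : X.toGlobSet ≅ Y.toGlobSet) :
    X.vertexList.map e.hom.app = Y.vertexList := by
  letI := Y.vertexOrder
  have h1 : (X.vertexList.map e.hom.app).Pairwise (fun a b => a < b) := by
    rw [List.pairwise_map]
    refine X.pairwise_vertexList.imp fun {a b} h => lt_of_le_of_ne ?_ fun h' => h.2 ?_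
    · exact (GlobSet.iso_le e).2 h.1
    · rw [← GlobSet.inv_app e a, h', GlobSet.inv_app]
  have h2 : Y.vertexList.Pairwise (fun a b => a < b) :=
    Y.pairwise_vertexList.imp fun h => lt_of_le_of_ne h.1 h.2
  refine List.Subset.antisymm_of_sortedLT (fun a _ => Y.mem_vertexList a) (fun a _ => ?_)
    h1.sortedLT h2.sortedLT
  rw [List.mem_map]
  exact ⟨e.inv.app a, X.mem_vertexList _, GlobSet.hom_app e a⟩

end GlobCard

/-! ## Enriched graphs and ordinal graphs -/

/-- Iterated enriched graphs: a set of vertices and, for each pair of vertices, an edge-object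
that is again an enriched graph. The empty graph is the one without vertices. -/
inductive EGraph : Type (u + 1)
  | mk (V : Type u) (E : V → V → EGraph) : EGraph

namespace EGraph

/-- The set of vertices. -/
def Vert : EGraph.{u} → Type u
  | mk V _ => V

/-- The empty graph. -/
def empty : EGraph.{u} := mk PEmpty (fun x _ => x.elim)

/-- An ordinal graph: the vertices form a finite linearly ordered set, the edge-object from `x`
to `y` is not the empty graph if and only if `y` is the successor of `x`, and the edge-objects
are again ordinal graphs. -/
def IsOrdinal : EGraph.{u} → Prop
  | mk V E => Finite V ∧
      (∃ _ : LinearOrder V, ∀ x y : V, Nonempty (E x y).Vert ↔ x ⋖ y) ∧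
      ∀ x y : V, (E x y).IsOrdinal

end EGraph

/-- Ordinal graphs. -/
structure OGraph where
  toEGraph : EGraph.{u}
  isOrdinal : toEGraph.IsOrdinal

namespace GlobCard

/-- The graph of a globular cardinal of dimension at most `n`: its vertices are the
`0`-vertices `X_0`, and its edge-object from `y` to `z` is the graph of the restriction `X(y,z)`
for consecutive `y`, `z`, and empty otherwise. -/
def graphAux : ℕ → GlobCard.{u} → EGraph.{u}
  | 0, X => .mk (X.cell 0) fun _ _ => .empty
  | n + 1, X => .mk (X.cell 0) fun y z => graphAux n (X.restr y z)

theorem graphAux_vert (n : ℕ) (X : GlobCard.{u}) : (graphAux n X).Vert = X.cell 0 := by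
  cases n <;> rfl

theorem restr_nonempty (X : GlobCard.{u}) {y z : X.cell 0} (h : X.Consec y z) :
    Nonempty ((X.restr y z).cell 0) := by
  obtain ⟨w, rfl, rfl⟩ := X.isCard.exists_of_consec h
  exact ⟨⟨w, X.isCard.mem_restrSub.2 (GlobSet.inHom_base (X := X.toGlobSet) w)⟩⟩

theorem consec_of_restr (X : GlobCard.{u}) {y z : X.cell 0}
    (h : Nonempty ((X.restr y z).cell 0)) : X.Consec y z := by
  obtain ⟨⟨w, S, ⟨hc, _⟩, _⟩⟩ := h
  exact hc

theorem graphAux_isOrdinal : ∀ (n : ℕ) (X : GlobCard.{u}), X.DimLE n →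
    (graphAux n X).IsOrdinal
  | 0, X, hX => by
    refine ⟨X.finite_cell 0, ⟨X.vertexOrder, fun x y => ⟨?_, fun h => ?_⟩⟩, fun _ _ => ?_⟩
    · rintro ⟨⟨⟩⟩
    · obtain ⟨w, _⟩ := X.isCard.exists_of_consec (X.consec_iff_covBy.2 h)
      exact ((hX 1 one_pos).false w).elim
    · exact ⟨inferInstanceAs (Finite PEmpty),
        ⟨(inferInstance : LinearOrder PEmpty), fun x => x.elim⟩, fun x => x.elim⟩
  | n + 1, X, hX => by
    refine ⟨X.finite_cell 0, ⟨X.vertexOrder, fun x y => ?_⟩, fun x y =>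
      graphAux_isOrdinal n (X.restr x y) (GlobSet.DimLE.restr hX x y)⟩
    rw [graphAux_vert, ← X.consec_iff_covBy]
    exact ⟨X.consec_of_restr, X.restr_nonempty⟩

/-- The ordinal graph `Γ X` of a globular cardinal `X`. -/
noncomputable def Gam (X : GlobCard.{u}) : OGraph.{u} :=
  ⟨graphAux X.dim X, graphAux_isOrdinal _ X X.dimLE_dim⟩

end GlobCard

/-! ## ω-categories -/

/-- The data of an `ω`-category: the set of all its cells, where an `n`-cell is identified with
the identity cells on it of higher dimensions; the sets of `n`-cells; the `m`-domain and
`m`-codomain of a cell; and the `m`-composition, `Comp m y x z` meaning that the composite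
`y ∘ₘ x` is defined and equal to `z`. -/
structure OmegaData where
  Cell : Type u
  IsCell : ℕ → Cell → Prop
  dom : ℕ → Cell → Cell
  cod : ℕ → Cell → Cell
  Comp : ℕ → Cell → Cell → Cell → Prop

/-- The axioms of a (strict) `ω`-category: each `(dom m, cod m, Comp m)` is a category, any two of
them form a `2`-category, and the dimension is finite. -/
structure OmegaData.IsOmegaCat (C : OmegaData.{u}) : Prop where
  isCell_iff : ∀ n x, C.IsCell n x ↔ C.dom n x = x
  finite_dim : ∃ n, ∀ x, C.IsCell n x
  dom_dom : ∀ m n x, m ≤ n → C.dom m (C.dom n x) = C.dom m x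
  cod_cod : ∀ m n x, m ≤ n → C.cod m (C.cod n x) = C.cod m x
  dom_cod : ∀ m n x, m < n → C.dom m (C.cod n x) = C.dom m x
  cod_dom : ∀ m n x, m < n → C.cod m (C.dom n x) = C.cod m x
  dom_dom' : ∀ m n x, m ≤ n → C.dom n (C.dom m x) = C.dom m x
  cod_dom' : ∀ m n x, m ≤ n → C.cod n (C.dom m x) = C.dom m x
  dom_cod' : ∀ m n x, m ≤ n → C.dom n (C.cod m x) = C.cod m x
  cod_cod' : ∀ m n x, m ≤ n → C.cod n (C.cod m x) = C.cod m x
  comp_exists : ∀ m y x, C.dom m y = C.cod m x ↔ ∃ z, C.Comp m y x z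
  comp_unique : ∀ m y x z z', C.Comp m y x z → C.Comp m y x z' → z = z'
  dom_comp : ∀ m y x z, C.Comp m y x z → C.dom m z = C.dom m x
  cod_comp : ∀ m y x z, C.Comp m y x z → C.cod m z = C.cod m y
  comp_dom : ∀ m x, C.Comp m x (C.dom m x) x
  cod_comp_self : ∀ m x, C.Comp m (C.cod m x) x x
  assoc : ∀ m z y x zy yx w, C.Comp m z y zy → C.Comp m y x yx →
    (C.Comp m zy x w ↔ C.Comp m z yx w)
  dom_comp' : ∀ m n y x z, m < n → C.Comp m y x z → C.Comp m (C.dom n y) (C.dom n x) (C.dom n z)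
  cod_comp' : ∀ m n y x z, m < n → C.Comp m y x z → C.Comp m (C.cod n y) (C.cod n x) (C.cod n z)
  interchange : ∀ m n y' y x' x a' a b c w, m < n →
    C.Comp n y' x' a' → C.Comp n y x a → C.Comp m y' y b → C.Comp m x' x c →
    (C.Comp m a' a w ↔ C.Comp n b c w)

/-- `F` is an `ω`-functor. -/
structure IsOmegaFunctor (C : OmegaData.{u}) (D : OmegaData.{v}) (F : C.Cell → D.Cell) :
    Prop where
  map_isCell : ∀ n x, C.IsCell n x → D.IsCell n (F x)
  map_dom : ∀ m x, F (C.dom m x) = D.dom m (F x)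
  map_cod : ∀ m x, F (C.cod m x) = D.cod m (F x)
  map_comp : ∀ m y x z, C.Comp m y x z → D.Comp m (F y) (F x) (F z)

/-- `F` is an isomorphism of `ω`-categories: an `ω`-functor with an inverse `ω`-functor. -/
def IsOmegaIso (C : OmegaData.{u}) (D : OmegaData.{v}) (F : C.Cell → D.Cell) : Prop :=
  IsOmegaFunctor C D F ∧ ∃ G : D.Cell → C.Cell, IsOmegaFunctor D C G ∧
    Function.LeftInverse G F ∧ Function.RightInverse G F

/-! ## The free ω-category on a globular cardinal -/

namespace GlobCard

/-- A morphism of globular cardinals `γ : Y ⟶ X` with `Y` non-empty. -/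
structure Over (X : GlobCard.{u}) where
  left : GlobCard.{u}
  nonempty : Nonempty (left.cell 0)
  map : left.toGlobSet ⟶ X.toGlobSet

/-- Isomorphism of objects over `X`. -/
instance overSetoid (X : GlobCard.{u}) : Setoid X.Over where
  r γ γ' := ∃ e : γ.left.toGlobSet ≅ γ'.left.toGlobSet, e.hom ≫ γ'.map = γ.map
  iseqv :=
    { refl := fun γ => ⟨Iso.refl _, Category.id_comp _⟩
      symm := fun ⟨e, h⟩ => ⟨e.symm, by rw [← h]; simp⟩
      trans := fun ⟨e, h⟩ ⟨e', h'⟩ => ⟨e ≪≫ e', by rw [← h, ← h']; simp⟩ }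

/-- The composite of `γ : Y ⟶ X` with the inclusion of the `m`-source (`ε = false`) or of the
`m`-target (`ε = true`) of `Y`. -/
def Over.bdry {X : GlobCard.{u}} (ε : Bool) (m : ℕ) (γ : X.Over) : X.Over where
  left := ⟨(γ.left.bdry ε m).toGlobSet, γ.left.isCard.bdry ε m⟩
  nonempty := γ.left.isCard.bdry_nonempty ε m γ.nonempty
  map := (γ.left.bdry ε m).incl ≫ γ.map

theorem Over.bdry_equiv {X : GlobCard.{u}} (ε : Bool) (m : ℕ) {γ γ' : X.Over} (h : γ ≈ γ') :
    γ.bdry ε m ≈ γ'.bdry ε m := by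
  obtain ⟨e, h⟩ := h
  exact ⟨GlobSet.bdryIso e ε m, by
    refine GlobSet.hom_ext fun n x => ?_
    exact congrArg (fun f : γ.left.toGlobSet ⟶ X.toGlobSet => f.app x.1) h⟩

/-- `δ` is the composite `β ∘ₘ α` of `α : Y ⟶ X` and `β : Z ⟶ X`: there is an isomorphism `φ`
over `X` of the `m`-source of `Z` with the `m`-target of `Y`, and `δ` is the morphism out of the
pushout that `α` and `β` induce. -/
def Over.IsComp {X : GlobCard.{u}} (m : ℕ) (β α δ : X.Over) : Prop :=
  ∃ (φ : (β.left.bdry false m).toGlobSet ≅ (α.left.bdry true m).toGlobSet)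
    (i : α.left.toGlobSet ⟶ δ.left.toGlobSet) (j : β.left.toGlobSet ⟶ δ.left.toGlobSet),
    φ.hom ≫ (α.left.bdry true m).incl ≫ α.map = (β.left.bdry false m).incl ≫ β.map ∧
    IsPushout (β.left.bdry false m).incl (φ.hom ≫ (α.left.bdry true m).incl) j i ∧
    i ≫ δ.map = α.map ∧ j ≫ δ.map = β.map

/-- The free `ω`-category `𝔉 X` on a globular cardinal `X`. -/
def free (X : GlobCard.{u}) : OmegaData.{u + 1} where
  Cell := Quotient X.overSetoid
  IsCell n := Quotient.lift (fun γ => γ.left.DimLE n) fun γ γ' ⟨e, _⟩ => propext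
    ⟨fun h m hm => ⟨fun y => (h m hm).false (e.inv.app y)⟩,
      fun h m hm => ⟨fun y => (h m hm).false (e.hom.app y)⟩⟩
  dom m := Quotient.map (Over.bdry false m) fun _ _ h => Over.bdry_equiv _ _ h
  cod m := Quotient.map (Over.bdry true m) fun _ _ h => Over.bdry_equiv _ _ h
  Comp m b a d := ∃ β α δ : X.Over, ⟦β⟧ = b ∧ ⟦α⟧ = a ∧ ⟦δ⟧ = d ∧ Over.IsComp m β α δ

end GlobCard

/-! ## The free ω-category on an enriched graph -/

/-- Finite sequences `x = x₀, x₁, …, x_n = y` with an element of `H x_{i-1} x_i` for each `i`. -/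
inductive EPath {V : Type u} (H : V → V → Type v) : V → V → Type (max u v)
  | nil (x : V) : EPath H x x
  | cons {x y z : V} (c : H x y) (p : EPath H y z) : EPath H x z

namespace EPath

variable {V : Type u} {H : V → V → Type v}

/-- Concatenation. -/
def append : ∀ {x y z : V}, EPath H x y → EPath H y z → EPath H x z
  | _, _, _, nil _, q => q
  | _, _, _, cons c p, q => cons c (p.append q)

/-- Apply a map to each entry. -/
def map (f : ∀ x y, H x y → H x y) : ∀ {x y : V}, EPath H x y → EPath H x y
  | _, _, nil x => nil x
  | _, _, cons c p => cons (f _ _ c) (p.map f)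

/-- All entries satisfy a predicate. -/
def All (P : ∀ x y, H x y → Prop) : ∀ {x y : V}, EPath H x y → Prop
  | _, _, nil _ => True
  | _, _, cons c p => P _ _ c ∧ p.All P

/-- The sequence is empty. -/
def IsNil : ∀ {x y : V}, EPath H x y → Prop
  | _, _, nil _ => True
  | _, _, cons _ _ => False

/-- Three sequences with the same vertices whose entries are related componentwise. -/
inductive Rel (R : ∀ x y, H x y → H x y → H x y → Prop) :
    ∀ {x y : V}, EPath H x y → EPath H x y → EPath H x y → Prop
  | nil (x : V) : Rel R (.nil x) (.nil x) (.nil x)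
  | cons {x y z : V} {c c' c'' : H x y} {p p' p'' : EPath H y z} :
      R x y c c' c'' → Rel R p p' p'' → Rel R (.cons c p) (.cons c' p') (.cons c'' p'')

end EPath

namespace EGraph

/-- The cells of `𝔉 𝒢`: the hom-object from `x` to `y` is the sum, over all sequences of vertices
`x = x₀, …, x_n = y`, of the products of the `𝔉 (𝒢 (x_{i-1}, x_i))`; the empty sequence at `x`
is the object `x`, with its identities. -/
def Cell : EGraph.{u} → Type u
  | mk V E => Σ x y : V, EPath (fun a b => (E a b).Cell) x y

/-- The `0`-cells are the objects; the `(n+1)`-cells are the sequences of `n`-cells. -/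
def IsCell : ∀ (G : EGraph.{u}), ℕ → G.Cell → Prop
  | mk _ _, 0, ⟨_, _, p⟩ => p.IsNil
  | mk _ E, n + 1, ⟨_, _, p⟩ => p.All fun a b => (E a b).IsCell n

/-- The `0`-domain is the first object, the `(m+1)`-domain is the sequence of `m`-domains. -/
def dom : ∀ (G : EGraph.{u}), ℕ → G.Cell → G.Cell
  | mk _ _, 0, ⟨x, _, _⟩ => ⟨x, x, .nil x⟩
  | mk _ E, m + 1, ⟨x, y, p⟩ => ⟨x, y, p.map fun a b => (E a b).dom m⟩

/-- The `0`-codomain is the last object, the `(m+1)`-codomain is the sequence of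
`m`-codomains. -/
def cod : ∀ (G : EGraph.{u}), ℕ → G.Cell → G.Cell
  | mk _ _, 0, ⟨_, y, _⟩ => ⟨y, y, .nil y⟩
  | mk _ E, m + 1, ⟨x, y, p⟩ => ⟨x, y, p.map fun a b => (E a b).cod m⟩

/-- The `0`-composition is concatenation, the `(m+1)`-composition is the `m`-composition in
each entry. `Comp G m q p r` means that `q ∘ₘ p` is defined and equal to `r`. -/
def Comp : ∀ (G : EGraph.{u}), ℕ → G.Cell → G.Cell → G.Cell → Prop
  | mk V E, 0, q, p, r => ∃ (x y z : V) (p' : EPath (fun a b => (E a b).Cell) x y)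
      (q' : EPath (fun a b => (E a b).Cell) y z),
      p = ⟨x, y, p'⟩ ∧ q = ⟨y, z, q'⟩ ∧ r = ⟨x, z, p'.append q'⟩
  | mk V E, m + 1, q, p, r => ∃ (x y : V) (q' p' r' : EPath (fun a b => (E a b).Cell) x y),
      q = ⟨x, y, q'⟩ ∧ p = ⟨x, y, p'⟩ ∧ r = ⟨x, y, r'⟩ ∧
      EPath.Rel (fun a b => (E a b).Comp m) q' p' r'

/-- The free `ω`-category `𝔉 𝒢` on an enriched graph `𝒢`. -/
def free (G : EGraph.{u}) : OmegaData.{u} where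
  Cell := G.Cell
  IsCell := G.IsCell
  dom := G.dom
  cod := G.cod
  Comp := G.Comp

end EGraph

/-! ## The comparison functor -/

/-- The sequence `f y₀, …, f y_p` with entries `g y_{i-1} y_i`, for a list of successively
related elements `y₀, …, y_p`. -/
def EPath.ofChain {U : Type w} {V : Type u} {H : V → V → Type v} {c : U → U → Prop}
    (f : U → V) (g : ∀ a b, c a b → H (f a) (f b)) :
    ∀ (a : U) (l : List U), (a :: l).IsChain c → Σ z : V, EPath H (f a) z
  | a, [], _ => ⟨f a, .nil (f a)⟩
  | a, b :: l, h =>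
    have h' := List.isChain_cons_cons.1 h
    ⟨(ofChain f g b l h'.2).1, .cons (g a b h'.1) (ofChain f g b l h'.2).2⟩

namespace GlobCard

/-- The map `L` on morphisms `γ : Y ⟶ X` with `X` of dimension at most `n`: if `y₀, …, y_p` are
the `0`-vertices of `Y`, it sends `γ` to the sequence, from `γ y₀` to `γ y_p`, of the
`L (γ (y_{i-1}, y_i))`. -/
noncomputable def compareAux : ∀ (n : ℕ) (X Y : GlobCard.{u}) (_ : Nonempty (Y.cell 0))
    (_ : Y.toGlobSet ⟶ X.toGlobSet), (graphAux n X).Cell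
  | 0, _, Y, hY, γ =>
    let y₀ := Y.vertexList.head (Y.vertexList_ne_nil hY)
    ⟨γ.app y₀, γ.app y₀, .nil _⟩
  | n + 1, X, Y, hY, γ =>
    let y₀ := Y.vertexList.head (Y.vertexList_ne_nil hY)
    ⟨γ.app y₀, EPath.ofChain (c := fun a b => Y.Consec a b) γ.app
      (fun a b h => compareAux n (X.restr (γ.app a) (γ.app b)) (Y.restr a b)
        (Y.restr_nonempty h) (restrHom γ a b)) y₀ Y.vertexList.tail
      (by rw [List.cons_head_tail]; exact Y.isChain_vertexList)⟩

/-- The restriction of an isomorphism. -/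
def restrIso {Y Y' : GlobCard.{u}} (e : Y.toGlobSet ≅ Y'.toGlobSet) (a b : Y.cell 0) :
    (Y.restr a b).toGlobSet ≅ (Y'.restr (e.hom.app a) (e.hom.app b)).toGlobSet where
  hom := restrHom e.hom a b
  inv := GlobSet.Hom.restrict (GlobSet.Hom.shift e.inv) _ _ fun x h => by
    have := GlobSet.Hom.inHom_app e.inv (Y'.isCard.mem_restrSub.1 h)
    rw [GlobSet.inv_app, GlobSet.inv_app] at this
    exact Y.isCard.mem_restrSub.2 this
  hom_inv_id := GlobSet.hom_ext fun _ x => Subtype.ext (GlobSet.inv_app e (n := _ + 1) x.1)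
  inv_hom_id := GlobSet.hom_ext fun _ x => Subtype.ext (GlobSet.hom_app e (n := _ + 1) x.1)

theorem ofChain_map {U U' : Type w} {V : Type u} {H : V → V → Type v} {c : U → U → Prop}
    {c' : U' → U' → Prop} (e : U → U') (f : U' → V) (g : ∀ a b, c a b → H (f (e a)) (f (e b)))
    (g' : ∀ a b, c' a b → H (f a) (f b)) (hc : ∀ a b, c a b → c' (e a) (e b))
    (hg : ∀ a b h, g a b h = g' (e a) (e b) (hc a b h)) :
    ∀ (a : U) (l : List U) (h : (a :: l).IsChain c) (h' : (e a :: l.map e).IsChain c'),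
      EPath.ofChain (fun x => f (e x)) g a l h = EPath.ofChain f g' (e a) (l.map e) h'
  | a, [], _, _ => rfl
  | a, b :: l, h, h' => by
    have ih := ofChain_map e f g g' hc hg b l (List.isChain_cons_cons.1 h).2
      (List.isChain_cons_cons.1 h').2
    simp only [List.map_cons, EPath.ofChain]
    rw [← ih, hg]

theorem compareAux_equiv : ∀ (n : ℕ) (X Y Y' : GlobCard.{u}) (hY : Nonempty (Y.cell 0))
    (hY' : Nonempty (Y'.cell 0)) (e : Y.toGlobSet ≅ Y'.toGlobSet)
    (γ' : Y'.toGlobSet ⟶ X.toGlobSet),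
    compareAux n X Y hY (e.hom ≫ γ') = compareAux n X Y' hY' γ'
  | 0, X, Y, Y', hY, hY', e, γ' => by
    have h : e.hom.app (Y.vertexList.head (Y.vertexList_ne_nil hY)) =
        Y'.vertexList.head (Y'.vertexList_ne_nil hY') := by
      simp only [← map_vertexList e, List.head_map]
    simp only [compareAux]
    rw [← h]
    rfl
  | n + 1, X, Y, Y', hY, hY', e, γ' => by
    have key : ∀ (K : List (Y.cell 0)) (K' : List (Y'.cell 0)) (_ : K.map e.hom.app = K')
        (h : K ≠ []) (h' : K' ≠ [])
        (hc : (K.head h :: K.tail).IsChain (fun a b => Y.Consec a b))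
        (hc' : (K'.head h' :: K'.tail).IsChain (fun a b => Y'.Consec a b)),
        (⟨(e.hom ≫ γ').app (K.head h), EPath.ofChain (c := fun a b => Y.Consec a b)
          (e.hom ≫ γ').app
          (fun a b h => compareAux n (X.restr ((e.hom ≫ γ').app a) ((e.hom ≫ γ').app b))
            (Y.restr a b) (Y.restr_nonempty h) (restrHom (e.hom ≫ γ') a b))
          (K.head h) K.tail hc⟩ : (graphAux (n + 1) X).Cell) =
        ⟨γ'.app (K'.head h'), EPath.ofChain (c := fun a b => Y'.Consec a b) γ'.app
          (fun a b h => compareAux n (X.restr (γ'.app a) (γ'.app b))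
            (Y'.restr a b) (Y'.restr_nonempty h) (restrHom γ' a b))
          (K'.head h') K'.tail hc'⟩ := by
      rintro K K' rfl h h' hc hc'
      rcases K with _ | ⟨y, K⟩
      · exact absurd rfl h
      · refine congrArg (Sigma.mk (γ'.app (e.hom.app y))) ?_
        refine ofChain_map (c := fun a b => Y.Consec a b) (c' := fun a b => Y'.Consec a b)
          e.hom.app γ'.app _ _ (fun a b h => GlobSet.iso_consec e h) (fun a b hab => ?_) _ _ _ _
        exact compareAux_equiv n (X.restr (γ'.app (e.hom.app a)) (γ'.app (e.hom.app b)))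
          (Y.restr a b) (Y'.restr (e.hom.app a) (e.hom.app b)) _ _ (restrIso e a b)
          (restrHom γ' (e.hom.app a) (e.hom.app b))
    exact key _ _ (map_vertexList e) _ _ _ _

/-- The map `L` from the cells of `𝔉 X` to the cells of `𝔉 (Γ X)`. -/
noncomputable def compare (X : GlobCard.{u}) : X.free.Cell → X.Gam.toEGraph.free.Cell :=
  Quotient.lift (fun γ => compareAux X.dim X γ.left γ.nonempty γ.map) fun γ γ' ⟨e, h⟩ => by
    rw [← h]
    exact compareAux_equiv _ _ _ _ _ _ e γ'.map

end GlobCard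

/-!
Every morphism of globular cardinals is injective: a nontrivial chain `x ≺ v ≺ ⋯ ≺ y` is sent to a
chain of the same kind, whose first step changes the dimension, so that antisymmetry in the target
forbids its ends to agree (`GlobSet.Hom.app_injective`). Hence a cell of `𝔉 X` is the same thing as
a subfunctor of `X` that is a nonempty globular cardinal, namely the image of any morphism that
represents it (`GlobCard.Over.equiv_iff_im_eq`). In these terms the boundaries are described by the
order of `X` alone (`GlobSet.Sub.bd`, `GlobSet.im_bdry`), and `δ` is the composite `β ∘ₘ α` if and
only if the `m`-source of `β` and the `m`-target of `α` have the same image and the image of `δ` is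
the union of those of `α` and `β`, provided that these meet only in that common boundary
(`GlobCard.Over.IsComp.im_eq`, `GlobCard.Over.isComp_of_im`).

On the other side a cell of `𝔉 (Γ X)`, a path of consecutive vertices with cells of smaller
dimension on its edges, supports a subfunctor of `X` (`GlobCard.supp`): the vertices of the path
together with what the edges support. The predicate `GlobCard.IsSupport` collects what is needed of
this assignment: it is injective, its values are nonempty globular cardinals, it turns domains and
codomains into boundaries, and composites into unions of subfunctors that meet in the common
boundary. It is inherited from the edges by the whole graph (`GlobCard.IsSupport.mk_graph`),
essentially because different edges of a path lie in disjoint open intervals of the order.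

The subfunctor that `L γ` supports is the image of `γ` (`GlobCard.supp_compare`). So `L` is
bijective and preserves and reflects cells, boundaries and composition. The axioms of an
`ω`-category hold in `𝔉 𝒢` by induction on the ordinal graph `𝒢`
(`EGraph.IsOrdinal.free_isOmegaCat`), and `L` carries them over to `𝔉 X`.
-/

/-! ### Sequences of edges -/

namespace EPath

variable {V : Type u} {H : V → V → Type v} {R : ∀ x y, H x y → H x y → H x y → Prop}

theorem map_map {f g k : ∀ x y, H x y → H x y} (h : ∀ a b c, g a b (f a b c) = k a b c) :
    ∀ {x y : V} (p : EPath H x y), (p.map f).map g = p.map k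
  | _, _, nil _ => rfl
  | _, _, cons c p => by simp only [map, h, map_map h p]

theorem map_eq_self_iff (f : ∀ x y, H x y → H x y) : ∀ {x y : V} (p : EPath H x y),
    p.map f = p ↔ p.All fun a b c => f a b c = c
  | _, _, nil _ => ⟨fun _ => trivial, fun _ => rfl⟩
  | _, _, cons c p => by
    simp only [map, All, cons.injEq, heq_eq_eq, true_and, map_eq_self_iff f p]

theorem all_iff_all {P Q : ∀ x y, H x y → Prop} (h : ∀ a b c, P a b c ↔ Q a b c) {x y : V}
    (p : EPath H x y) : p.All P ↔ p.All Q := by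
  rw [show P = Q from funext fun a => funext fun b => funext fun c => propext (h a b c)]

theorem all_of_forall {P : ∀ x y, H x y → Prop} (h : ∀ a b c, P a b c) : ∀ {x y : V}
    (p : EPath H x y), p.All P
  | _, _, nil _ => trivial
  | _, _, cons c p => ⟨h _ _ c, all_of_forall h p⟩

theorem isNil_iff : ∀ {x y : V} (p : EPath H x y),
    p.IsNil ↔ (⟨x, x, nil x⟩ : Σ a b : V, EPath H a b) = ⟨x, y, p⟩
  | _, _, nil _ => ⟨fun _ => rfl, fun _ => trivial⟩
  | _, _, cons c p => ⟨fun h => h.elim, fun h => by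
      rw [Sigma.mk.injEq] at h
      obtain ⟨-, h⟩ := h
      have h := eq_of_heq h
      rw [Sigma.mk.injEq] at h
      obtain ⟨rfl, h⟩ := h
      exact absurd (eq_of_heq h) (by simp)⟩

theorem append_nil : ∀ {x y : V} (p : EPath H x y), p.append (nil y) = p
  | _, _, nil _ => rfl
  | _, _, cons c p => congrArg (cons c) (append_nil p)

theorem append_assoc : ∀ {x y z t : V} (p : EPath H x y) (q : EPath H y z) (r : EPath H z t),
    (p.append q).append r = p.append (q.append r)
  | _, _, _, _, nil _, _, _ => rfl
  | _, _, _, _, cons c p, q, r => congrArg (cons c) (append_assoc p q r)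

theorem map_append (f : ∀ x y, H x y → H x y) : ∀ {x y z : V} (p : EPath H x y)
    (q : EPath H y z), (p.append q).map f = (p.map f).append (q.map f)
  | _, _, _, nil _, _ => rfl
  | _, _, _, cons c p, q => congrArg (cons (f _ _ c)) (map_append f p q)

theorem map_eq_map_iff {f g : ∀ x y, H x y → H x y}
    (h : ∀ a b c d, f a b c = g a b d ↔ ∃ e, R a b c d e) : ∀ {x y : V} (p q : EPath H x y),
    p.map f = q.map g ↔ ∃ r, Rel R p q r
  | _, _, nil _, nil _ => ⟨fun _ => ⟨_, .nil _⟩, fun _ => rfl⟩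
  | _, _, nil _, cons c q => ⟨nofun, nofun⟩
  | _, _, cons c q, nil _ => ⟨nofun, nofun⟩
  | _, _, cons c p, cons d q => by
    constructor
    · intro hh
      simp only [map, cons.injEq] at hh
      obtain ⟨rfl, h1, h2⟩ := hh
      obtain ⟨e, he⟩ := (h _ _ c d).1 (eq_of_heq h1)
      obtain ⟨r, hr⟩ := (map_eq_map_iff h p q).1 (eq_of_heq h2)
      exact ⟨_, .cons he hr⟩
    · rintro ⟨r, hr⟩
      cases hr with
      | cons h1 h2 =>
        simp only [map]
        rw [(h _ _ _ _).2 ⟨_, h1⟩, (map_eq_map_iff h _ _).2 ⟨_, h2⟩]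

namespace Rel

theorem unique (h : ∀ a b c d e e', R a b c d e → R a b c d e' → e = e') {x y : V}
    {p q r r' : EPath H x y} (h1 : Rel R p q r) (h2 : Rel R p q r') : r = r' := by
  induction h1 with
  | nil => cases h2; rfl
  | cons hc hp ih =>
    cases h2 with
    | cons hc' hp' => rw [h _ _ _ _ _ _ hc hc', ih hp']

theorem map₃ {S : ∀ x y, H x y → H x y → H x y → Prop} {f g k : ∀ x y, H x y → H x y}
    (h : ∀ a b c d e, R a b c d e → S a b (f a b c) (g a b d) (k a b e)) {x y : V}
    {p q r : EPath H x y} (h1 : Rel R p q r) : Rel S (p.map f) (q.map g) (r.map k) := by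
  induction h1 with
  | nil => exact .nil _
  | cons hc hp ih => exact .cons (h _ _ _ _ _ hc) ih

theorem of_forall {f g k : ∀ x y, H x y → H x y}
    (h : ∀ a b c, R a b (f a b c) (g a b c) (k a b c)) : ∀ {x y : V}
    (p : EPath H x y), Rel R (p.map f) (p.map g) (p.map k)
  | _, _, .nil _ => .nil _
  | _, _, .cons c p => .cons (h _ _ c) (of_forall h p)

theorem map_eq {f g k : ∀ x y, H x y → H x y} {x y : V} {p q r : EPath H x y}
    (h1 : Rel R p q r) : ((∀ a b c d e, R a b c d e → f a b e = g a b c) →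
      r.map f = p.map g) ∧ ((∀ a b c d e, R a b c d e → f a b e = k a b d) →
      r.map f = q.map k) := by
  induction h1 with
  | nil => exact ⟨fun _ => rfl, fun _ => rfl⟩
  | cons hc hp ih =>
    constructor <;> intro h <;> simp only [map]
    · rw [h _ _ _ _ _ hc, ih.1 h]
    · rw [h _ _ _ _ _ hc, ih.2 h]

theorem append {x y z : V} {p q r : EPath H x y} {p' q' r' : EPath H y z}
    (h : Rel R p q r) (h' : Rel R p' q' r') :
    Rel R (p.append p') (q.append q') (r.append r') := by
  induction h with
  | nil => exact h'
  | cons hc hp ih => exact .cons hc (ih h')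

theorem assoc (h : ∀ a b z y x zy yx w, R a b z y zy → R a b y x yx →
    (R a b zy x w ↔ R a b z yx w)) {s t : V} {z y x zy yx w : EPath H s t}
    (h1 : Rel R z y zy) (h2 : Rel R y x yx) : Rel R zy x w ↔ Rel R z yx w := by
  induction h1 with
  | nil =>
    cases h2; rfl
  | cons hc hp ih =>
    cases h2 with
    | cons hc' hp' =>
      constructor
      · intro h3
        cases h3 with
        | cons hc'' hp'' => exact .cons ((h _ _ _ _ _ _ _ _ hc hc').1 hc'') ((ih hp').1 hp'')
      · intro h3
        cases h3 with
        | cons hc'' hp'' => exact .cons ((h _ _ _ _ _ _ _ _ hc hc').2 hc'') ((ih hp').2 hp'')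

theorem interchange {S : ∀ x y, H x y → H x y → H x y → Prop}
    (h : ∀ s t y' y x' x a' a b c w, S s t y' x' a' → S s t y x a → R s t y' y b → R s t x' x c →
      (R s t a' a w ↔ S s t b c w)) {s t : V} {y' y x' x a' a b c w : EPath H s t}
    (h1 : Rel S y' x' a') (h2 : Rel S y x a) (h3 : Rel R y' y b) (h4 : Rel R x' x c) :
    Rel R a' a w ↔ Rel S b c w := by
  induction h1 with
  | nil =>
    cases h3; cases h4; cases h2
    exact ⟨fun h => by cases h; exact .nil _, fun h => by cases h; exact .nil _⟩
  | cons hc hp ih =>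
    cases h3 with
    | cons hc3 hp3 =>
    cases h4 with
    | cons hc4 hp4 =>
    cases h2 with
    | cons hc2 hp2 =>
      constructor
      · intro h5
        cases h5 with
        | cons hc5 hp5 =>
          exact .cons ((h _ _ _ _ _ _ _ _ _ _ _ hc hc2 hc3 hc4).1 hc5) ((ih hp2 hp3 hp4).1 hp5)
      · intro h5
        cases h5 with
        | cons hc5 hp5 =>
          exact .cons ((h _ _ _ _ _ _ _ _ _ _ _ hc hc2 hc3 hc4).2 hc5) ((ih hp2 hp3 hp4).2 hp5)

end Rel

end EPath

/-! ### The free ω-category on an ordinal graph -/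

namespace OmegaData.IsOmegaCat

theorem isCell_mono {C : OmegaData.{u}} (hC : C.IsOmegaCat) {m n : ℕ} (h : m ≤ n) {x : C.Cell}
    (hx : C.IsCell m x) : C.IsCell n x := by
  rw [hC.isCell_iff] at hx ⊢
  rw [← hx, hC.dom_dom' m n x h]

end OmegaData.IsOmegaCat

namespace EGraph

theorem cell_congr {V : Type u} {E : V → V → EGraph.{u}} {x y : V}
    {p q : EPath (fun a b => (E a b).Cell) x y} (h : p = q) :
    (⟨x, y, p⟩ : (mk V E).Cell) = ⟨x, y, q⟩ := by rw [h]

theorem eq_of_cell_eq {V : Type u} {E : V → V → EGraph.{u}} {x y : V}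
    {p q : EPath (fun a b => (E a b).Cell) x y}
    (h : (⟨x, y, p⟩ : (mk V E).Cell) = ⟨x, y, q⟩) : p = q := by
  cases h; rfl

/-- The axioms hold for `𝔉 𝒢` as soon as they hold for the `𝔉 (𝒢 (x, y))`: those on levels `≥ 1`
hold entrywise, and those that involve level `0` are properties of concatenation. -/
theorem free_isOmegaCat_mk {V : Type u} {E : V → V → EGraph.{u}} [Finite V]
    (hE : ∀ a b, (E a b).free.IsOmegaCat) : (mk V E).free.IsOmegaCat where
  isCell_iff := by
    rintro (_ | n) ⟨x, y, p⟩
    · exact EPath.isNil_iff p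
    · exact (EPath.all_iff_all (fun a b c => (hE a b).isCell_iff n c) p).trans
        ((EPath.map_eq_self_iff (fun a b => (E a b).dom n) p).symm.trans
          ⟨cell_congr, eq_of_cell_eq⟩)
  finite_dim := by
    choose N hN using fun a b => (hE a b).finite_dim
    obtain ⟨M, hM⟩ := (Set.finite_range fun i : V × V => N i.1 i.2).bddAbove
    refine ⟨M + 1, fun ⟨x, y, p⟩ => ?_⟩
    exact EPath.all_of_forall (fun a b c =>
      (hE a b).isCell_mono (hM ⟨(a, b), rfl⟩) (hN a b c)) p
  dom_dom := by
    rintro (_ | m) (_ | n) ⟨x, y, p⟩ h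
    · rfl
    · rfl
    · omega
    · exact cell_congr (EPath.map_map (fun a b c => (hE a b).dom_dom m n c (by omega)) p)
  cod_cod := by
    rintro (_ | m) (_ | n) ⟨x, y, p⟩ h
    · rfl
    · rfl
    · omega
    · exact cell_congr (EPath.map_map (fun a b c => (hE a b).cod_cod m n c (by omega)) p)
  dom_cod := by
    rintro (_ | m) (_ | n) ⟨x, y, p⟩ h
    · omega
    · rfl
    · omega
    · exact cell_congr (EPath.map_map (fun a b c => (hE a b).dom_cod m n c (by omega)) p)
  cod_dom := by
    rintro (_ | m) (_ | n) ⟨x, y, p⟩ h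
    · omega
    · rfl
    · omega
    · exact cell_congr (EPath.map_map (fun a b c => (hE a b).cod_dom m n c (by omega)) p)
  dom_dom' := by
    rintro (_ | m) (_ | n) ⟨x, y, p⟩ h
    · rfl
    · rfl
    · omega
    · exact cell_congr (EPath.map_map (fun a b c => (hE a b).dom_dom' m n c (by omega)) p)
  cod_dom' := by
    rintro (_ | m) (_ | n) ⟨x, y, p⟩ h
    · rfl
    · rfl
    · omega
    · exact cell_congr (EPath.map_map (fun a b c => (hE a b).cod_dom' m n c (by omega)) p)
  dom_cod' := by
    rintro (_ | m) (_ | n) ⟨x, y, p⟩ h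
    · rfl
    · rfl
    · omega
    · exact cell_congr (EPath.map_map (fun a b c => (hE a b).dom_cod' m n c (by omega)) p)
  cod_cod' := by
    rintro (_ | m) (_ | n) ⟨x, y, p⟩ h
    · rfl
    · rfl
    · omega
    · exact cell_congr (EPath.map_map (fun a b c => (hE a b).cod_cod' m n c (by omega)) p)
  comp_exists := by
    rintro (_ | m) ⟨x, y, p⟩ ⟨x', y', p'⟩
    · constructor
      · intro h
        obtain rfl : x = y' := congrArg Sigma.fst h
        exact ⟨_, _, _, _, _, _, rfl, rfl, rfl⟩
      · rintro ⟨_, a, b, c, q, q', h1, h2, rfl⟩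
        cases h1; cases h2; rfl
    · have key := fun x y => EPath.map_eq_map_iff (x := x) (y := y)
        (R := fun a b => (E a b).Comp m) (fun a b c d => (hE a b).comp_exists m c d)
      constructor
      · intro h
        obtain rfl : x = x' := congrArg Sigma.fst h
        obtain rfl : y = y' := congrArg (fun z : (mk V E).Cell => z.2.1) h
        obtain ⟨r, hr⟩ := (key _ _ p p').1 (eq_of_cell_eq h)
        exact ⟨⟨x, y, r⟩, _, _, _, _, _, rfl, rfl, rfl, hr⟩
      · rintro ⟨_, a, b, q', q, r, h1, h2, rfl, h⟩
        cases h1; cases h2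
        exact cell_congr ((key _ _ _ _).2 ⟨_, h⟩)
  comp_unique := by
    rintro (_ | m) _ _ _ _
    · rintro ⟨x, y, z, p, q, rfl, rfl, rfl⟩ ⟨x', y', z', p', q', h1, h2, rfl⟩
      cases h1; cases h2; rfl
    · rintro ⟨x, y, p, q, r, rfl, rfl, rfl, h⟩ ⟨x', y', p', q', r', h1, h2, rfl, h'⟩
      cases h1; cases h2
      rw [h.unique (fun a b => (hE a b).comp_unique m) h']
  dom_comp := by
    rintro (_ | m) _ _ _
    · rintro ⟨x, y, z, p, q, rfl, rfl, rfl⟩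
      rfl
    · rintro ⟨x, y, p, q, r, rfl, rfl, rfl, h⟩
      exact cell_congr
        ((h.map_eq (g := fun _ _ c => c)).2 (fun a b => (hE a b).dom_comp m))
  cod_comp := by
    rintro (_ | m) _ _ _
    · rintro ⟨x, y, z, p, q, rfl, rfl, rfl⟩
      rfl
    · rintro ⟨x, y, p, q, r, rfl, rfl, rfl, h⟩
      exact cell_congr
        ((h.map_eq (k := fun _ _ c => c)).1 (fun a b => (hE a b).cod_comp m))
  comp_dom := by
    rintro (_ | m) ⟨x, y, p⟩
    · exact ⟨x, x, y, .nil x, p, rfl, rfl, rfl⟩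
    · refine ⟨x, y, p, _, p, rfl, rfl, rfl, ?_⟩
      have := EPath.Rel.of_forall (R := fun a b => (E a b).Comp m) (f := fun _ _ c => c)
        (k := fun _ _ c => c) (fun a b c => (hE a b).comp_dom m c) p
      rwa [(EPath.map_eq_self_iff _ p).2 (EPath.all_of_forall (fun _ _ _ => rfl) p)] at this
  cod_comp_self := by
    rintro (_ | m) ⟨x, y, p⟩
    · exact ⟨x, y, y, p, .nil y, rfl, rfl, by rw [EPath.append_nil]⟩
    · refine ⟨x, y, _, p, p, rfl, rfl, rfl, ?_⟩
      have := EPath.Rel.of_forall (R := fun a b => (E a b).Comp m) (g := fun _ _ c => c)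
        (k := fun _ _ c => c) (fun a b c => (hE a b).cod_comp_self m c) p
      rwa [(EPath.map_eq_self_iff _ p).2 (EPath.all_of_forall (fun _ _ _ => rfl) p)] at this
  assoc := by
    rintro (_ | m) _ _ _ _ _ w
    · rintro ⟨x, y, z, p, q, rfl, rfl, rfl⟩ ⟨x', y', z', p', q', rfl, h2, rfl⟩
      cases h2
      constructor
      · rintro ⟨x₁, y₁, z₁, p₁, q₁, h1, h2, rfl⟩
        cases h1; cases h2
        exact ⟨_, _, _, _, _, rfl, rfl, by rw [EPath.append_assoc]⟩
      · rintro ⟨x₁, y₁, z₁, p₁, q₁, h1, h2, rfl⟩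
        cases h1; cases h2
        exact ⟨_, _, _, _, _, rfl, rfl, by rw [EPath.append_assoc]⟩
    · rintro ⟨x, y, p, q, r, rfl, rfl, rfl, h⟩ ⟨x', y', p', q', r', h1, rfl, rfl, h'⟩
      cases h1
      have key := fun w => EPath.Rel.assoc (w := w) (fun a b => (hE a b).assoc m) h h'
      constructor
      · rintro ⟨x₁, y₁, p₁, q₁, r₁, h1, h2, rfl, h₁⟩
        cases h1; cases h2
        exact ⟨_, _, _, _, _, rfl, rfl, rfl, (key _).1 h₁⟩
      · rintro ⟨x₁, y₁, p₁, q₁, r₁, h1, h2, rfl, h₁⟩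
        cases h1; cases h2
        exact ⟨_, _, _, _, _, rfl, rfl, rfl, (key _).2 h₁⟩
  dom_comp' := by
    rintro (_ | m) (_ | n) _ _ _ hmn
    · omega
    · rintro ⟨x, y, z, p, q, rfl, rfl, rfl⟩
      exact ⟨_, _, _, _, _, rfl, rfl, cell_congr (EPath.map_append _ p q)⟩
    · omega
    · rintro ⟨x, y, p, q, r, rfl, rfl, rfl, h⟩
      exact ⟨_, _, _, _, _, rfl, rfl, rfl,
        h.map₃ fun a b c d e => (hE a b).dom_comp' m n c d e (by omega)⟩
  cod_comp' := by
    rintro (_ | m) (_ | n) _ _ _ hmn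
    · omega
    · rintro ⟨x, y, z, p, q, rfl, rfl, rfl⟩
      exact ⟨_, _, _, _, _, rfl, rfl, cell_congr (EPath.map_append _ p q)⟩
    · omega
    · rintro ⟨x, y, p, q, r, rfl, rfl, rfl, h⟩
      exact ⟨_, _, _, _, _, rfl, rfl, rfl,
        h.map₃ fun a b c d e => (hE a b).cod_comp' m n c d e (by omega)⟩
  interchange := by
    rintro (_ | m) (_ | n) _ _ _ _ _ _ _ _ w hmn
    · omega
    · rintro ⟨s, t, y', x', a', rfl, rfl, rfl, h1⟩ ⟨s', t', y, x, a, rfl, rfl, rfl, h2⟩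
        ⟨_, _, _, _, _, e1, e2, rfl⟩ ⟨_, _, _, _, _, e3, e4, rfl⟩
      cases e1; cases e2; cases e3; cases e4
      constructor
      · rintro ⟨_, _, _, _, _, e1, e2, rfl⟩
        cases e1; cases e2
        exact ⟨_, _, _, _, _, rfl, rfl, rfl, h2.append h1⟩
      · rintro ⟨_, _, _, _, _, e1, e2, rfl, h⟩
        cases e1; cases e2
        exact ⟨_, _, _, _, _, rfl, rfl, by
          rw [h.unique (fun a b => (hE a b).comp_unique n) (h2.append h1)]⟩
    · omega
    · rintro ⟨s, t, y', x', a', rfl, rfl, rfl, h1⟩ ⟨s', t', y, x, a, rfl, rfl, rfl, h2⟩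
        ⟨_, _, _, _, _, e1, e2, rfl, h3⟩ ⟨_, _, _, _, _, e3, e4, rfl, h4⟩
      cases e1; cases e2; cases e3; cases e4
      have key := fun w => EPath.Rel.interchange (w := w) (fun s t y' y x' x a' a b c w =>
        (hE s t).interchange m n y' y x' x a' a b c w (by omega)) h1 h2 h3 h4
      constructor
      · rintro ⟨_, _, _, _, _, e1, e2, rfl, h⟩
        cases e1; cases e2
        exact ⟨_, _, _, _, _, rfl, rfl, rfl, (key _).1 h⟩
      · rintro ⟨_, _, _, _, _, e1, e2, rfl, h⟩
        cases e1; cases e2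
        exact ⟨_, _, _, _, _, rfl, rfl, rfl, (key _).2 h⟩

theorem IsOrdinal.free_isOmegaCat : ∀ {G : EGraph.{u}}, G.IsOrdinal → G.free.IsOmegaCat
  | mk _ E, ⟨hV, _, hE⟩ =>
    have := hV
    free_isOmegaCat_mk fun a b => IsOrdinal.free_isOmegaCat (G := E a b) (hE a b)

end EGraph

/-! ### Order and boundaries in a globular cardinal -/

namespace GlobSet

variable {X Y Z : GlobSet.{u}}

theorem IsCard.eq_of_le (hX : X.IsCard) {n : ℕ} {x y : X.cell n} (h : X.le ⟨n, x⟩ ⟨n, y⟩)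
    (h' : X.le ⟨n, y⟩ ⟨n, x⟩) : x = y := by
  simpa using hX.antisymm _ _ h h'

theorem IsCard.not_le_of_ne (hX : X.IsCard) {n m : ℕ} {x : X.cell n} {y : X.cell m}
    (hnm : n ≠ m) (h : X.le ⟨n, x⟩ ⟨m, y⟩) : ¬ X.le ⟨m, y⟩ ⟨n, x⟩ := fun h' =>
  hnm (congrArg Sigma.fst (hX.antisymm _ _ h h'))

theorem Consec.unique_right (hX : X.IsCard) {k : ℕ} {a b c : X.cell k} (h : X.Consec a b)
    (h' : X.Consec a c) : b = c := by
  rcases hX.total ⟨k, b⟩ ⟨k, c⟩ with hbc | hbc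
  · exact (h'.eq_or h.le hbc).resolve_left fun e => h.1 e.symm
  · exact ((h.eq_or h'.le hbc).resolve_left fun e => h'.1 e.symm).symm

theorem Prec.dim_ne {u v : X.Vertex} (h : X.Prec u v) : u.1 ≠ v.1 := by
  cases h <;> simp

/-- A morphism of globular cardinals is injective: a nontrivial chain `x ≺ v ≺ ⋯ ≺ y` is sent to a
chain whose first step changes the dimension, so that its ends differ by antisymmetry. -/
theorem Hom.app_injective (hX : X.IsCard) (hY : Y.IsCard) (f : X ⟶ Y) {n : ℕ} :
    Function.Injective (f.app : X.cell n → Y.cell n) := by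
  have key : ∀ x y : X.cell n, X.le ⟨n, x⟩ ⟨n, y⟩ → f.app x = f.app y → x = y := by
    intro x y h he
    rcases Relation.ReflTransGen.cases_head h with h' | ⟨v, h1, h2⟩
    · simpa using h'
    · have h3 := Hom.le_app f (.single h1)
      have h4 := Hom.le_app f h2
      dsimp only at h3 h4
      rw [← he] at h4
      exact absurd h4 (hY.not_le_of_ne h1.dim_ne h3)
  intro x y he
  rcases hX.total ⟨n, x⟩ ⟨n, y⟩ with h | h
  · exact key x y h he
  · exact (key y x h he.symm).symm

namespace Sub

/-- The union of two subfunctors. -/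
def sup (S T : X.Sub) : X.Sub where
  mem n := S.mem n ∪ T.mem n
  src_mem := Or.imp S.src_mem T.src_mem
  tgt_mem := Or.imp S.tgt_mem T.tgt_mem

/-- The subfunctor that consists of a single `0`-vertex. -/
def pt (x : X.cell 0) : X.Sub where
  mem
    | 0 => {x}
    | _ + 1 => ∅
  src_mem h := h.elim
  tgt_mem h := h.elim

/-- The chains of `≺` that run inside the subfunctor `S`. -/
def Rel (S : X.Sub) : X.Vertex → X.Vertex → Prop :=
  Relation.ReflTransGen fun u v => X.Prec u v ∧ u.2 ∈ S.mem u.1 ∧ v.2 ∈ S.mem v.1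

/-- Any two vertices of `S` are joined by a chain inside `S`. -/
def Tot (S : X.Sub) : Prop :=
  ∀ u v : X.Vertex, u.2 ∈ S.mem u.1 → v.2 ∈ S.mem v.1 → S.Rel u v ∨ S.Rel v u

theorem Rel.le {S : X.Sub} {u v : X.Vertex} (h : S.Rel u v) : X.le u v :=
  Relation.ReflTransGen.mono (fun _ _ h => h.1) _ _ h

theorem Rel.mono {S T : X.Sub} (hST : ∀ n, S.mem n ⊆ T.mem n) {u v : X.Vertex}
    (h : S.Rel u v) : T.Rel u v :=
  Relation.ReflTransGen.mono (fun _ _ h => ⟨h.1, hST _ h.2.1, hST _ h.2.2⟩) _ _ h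

theorem rel_of_le {S : X.Sub} {u v : S.toGlobSet.Vertex} (h : S.toGlobSet.le u v) :
    S.Rel ⟨u.1, u.2.1⟩ ⟨v.1, v.2.1⟩ := by
  induction h with
  | refl => exact .refl
  | tail _ h ih =>
    refine ih.tail ⟨?_, Subtype.property _, Subtype.property _⟩
    cases h with
    | src y => exact Prec.src y.1
    | tgt y => exact Prec.tgt y.1

theorem Rel.le_toGlobSet {S : X.Sub} {u v : X.Vertex} (h : S.Rel u v) (hu : u.2 ∈ S.mem u.1)
    (hv : v.2 ∈ S.mem v.1) : S.toGlobSet.le ⟨u.1, u.2, hu⟩ ⟨v.1, v.2, hv⟩ := by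
  induction h with
  | refl => exact .refl
  | tail _ h ih =>
    obtain ⟨h, h1, h2⟩ := h
    refine (ih h1).tail ?_
    cases h with
    | src y => exact Prec.src (X := S.toGlobSet) ⟨y, h2⟩
    | tgt y => exact Prec.tgt (X := S.toGlobSet) ⟨y, h1⟩

theorem isCard_iff_tot (hX : X.IsCard) (S : X.Sub) : S.toGlobSet.IsCard ↔ S.Tot := by
  constructor
  · intro h u v hu hv
    exact (h.total ⟨u.1, u.2, hu⟩ ⟨v.1, v.2, hv⟩).imp rel_of_le rel_of_le
  · intro h
    refine isCard_of_total hX S fun ⟨n, x, hx⟩ ⟨m, y, hy⟩ hle => ?_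
    rcases h ⟨n, x⟩ ⟨m, y⟩ hx hy with h | h
    · exact h.le_toGlobSet hx hy
    · have he := hX.antisymm _ _ hle h.le
      obtain rfl : n = m := congrArg Sigma.fst he
      obtain rfl : x = y := by simpa using he
      exact .refl

theorem toGlobSet_le_iff (hX : X.IsCard) {S : X.Sub} (hS : S.toGlobSet.IsCard)
    {u v : S.toGlobSet.Vertex} :
    S.toGlobSet.le u v ↔ X.le ⟨u.1, u.2.1⟩ ⟨v.1, v.2.1⟩ := by
  refine ⟨le_incl, fun h => ?_⟩
  obtain ⟨n, x, hx⟩ := u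
  obtain ⟨m, y, hy⟩ := v
  rcases hS.total ⟨n, x, hx⟩ ⟨m, y, hy⟩ with h' | h'
  · exact h'
  · have he := hX.antisymm _ _ h (le_incl h')
    obtain rfl : n = m := congrArg Sigma.fst he
    obtain rfl : x = y := by simpa using he
    exact .refl

/-- A vertex of `S` in the hom from `a` to `b` is reached from `a`, and reaches `b`,
inside `S`. -/
theorem rel_of_inHom {S : X.Sub} {a b : X.cell 0} {n : ℕ} {w : X.cell n} (hw : w ∈ S.mem n)
    (h : X.InHom a b w) : S.Rel ⟨0, a⟩ ⟨n, w⟩ ∧ S.Rel ⟨n, w⟩ ⟨0, b⟩ := by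
  obtain ⟨a', b', h'⟩ := exists_inHom (X := S.toGlobSet) ⟨w, hw⟩ h.lt
  obtain ⟨rfl, rfl⟩ := h.unique (Hom.inHom_app S.incl h')
  exact ⟨rel_of_le h'.le_left, rel_of_le h'.le_right⟩

end Sub

/-- Parallel `n`-vertices: those with the same source and target, and any two `0`-vertices. -/
def Par (X : GlobSet.{u}) : ∀ {n : ℕ}, X.cell n → X.cell n → Prop
  | 0, _, _ => True
  | _ + 1, x, y => X.src x = X.src y ∧ X.tgt x = X.tgt y

theorem Par.inHom {a b : X.cell 0} : ∀ {n : ℕ} {x y : X.cell n}, X.Par x y → X.InHom a b x →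
    X.InHom a b y
  | 0, _, _, _, h => h.elim
  | 1, _, _, ⟨h1, h2⟩, h => inHom_base_iff.2 ⟨h1 ▸ h.base.1, h2 ▸ h.base.2⟩
  | n + 2, x, y, ⟨h1, _⟩, h => by
    rw [inHom_src (Nat.succ_pos n)] at h ⊢
    rwa [← h1]

/-- The `m`-source (`ε = false`) or `m`-target (`ε = true`) of a subfunctor `S` of `X`, in terms of
the order of `X`: the vertices of dimension `< m` and the extremal ones among parallel
`m`-vertices. -/
def Sub.bd (ε : Bool) (m : ℕ) (S : X.Sub) : X.Sub where
  mem n := {x | x ∈ S.mem n ∧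
    (n < m ∨ n = m ∧ ∀ y ∈ S.mem n, X.Par x y → X.ord ε ⟨n, x⟩ ⟨n, y⟩)}
  src_mem h := ⟨S.src_mem h.1, Or.inl (by have := h.2; omega)⟩
  tgt_mem h := ⟨S.tgt_mem h.1, Or.inl (by have := h.2; omega)⟩

theorem IsCard.mem_bdry_zero (hX : X.IsCard) {ε : Bool} {n : ℕ} {x : X.cell n} :
    x ∈ (X.bdry ε 0).mem n ↔ ∀ w, X.ord ε ⟨n, x⟩ w := by
  refine ⟨fun h => ?_, fun h => subset_smallest (B := X.bdryGen ε 0) (v := ⟨n, x⟩) h⟩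
  exact h { mem := fun n => {x | ∀ w, X.ord ε ⟨n, x⟩ w}
            src_mem := fun h => absurd (hX.dim_eq_zero h) (by simp)
            tgt_mem := fun h => absurd (hX.dim_eq_zero h) (by simp) } (fun v hv => hv)

theorem ord_trans {ε : Bool} {x y z : X.Vertex} (h : X.ord ε x y) (h' : X.ord ε y z) :
    X.ord ε x z := by
  cases ε
  · exact Relation.ReflTransGen.trans (r := X.Prec) h h'
  · exact Relation.ReflTransGen.trans (r := X.Prec) h' h

theorem Sub.toGlobSet_ord_iff (hX : X.IsCard) {S : X.Sub} (hS : S.toGlobSet.IsCard) {ε : Bool}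
    {u v : S.toGlobSet.Vertex} :
    S.toGlobSet.ord ε u v ↔ X.ord ε ⟨u.1, u.2.1⟩ ⟨v.1, v.2.1⟩ := by
  cases ε
  · exact toGlobSet_le_iff hX hS
  · exact toGlobSet_le_iff hX hS

/-- For a globular cardinal `S` contained in `X`, the boundaries of `S` as a globular set of its own
are those computed in the order of `X`, because the two orders agree on `S`. -/
theorem Sub.mem_bd_iff (hX : X.IsCard) {S : X.Sub} (hS : S.toGlobSet.IsCard) {ε : Bool}
    {m n : ℕ} (x : S.toGlobSet.cell n) :
    x.1 ∈ (S.bd ε m).mem n ↔ x ∈ (S.toGlobSet.bdry ε m).mem n := by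
  rcases m with _ | k
  · rw [hS.mem_bdry_zero]
    constructor
    · rintro ⟨_, h | ⟨rfl, h⟩⟩
      · omega
      · rintro ⟨n, w⟩
        -- a vertex of positive dimension lies between its `0`-source and its `0`-target
        have : ∃ c : S.toGlobSet.cell 0, S.toGlobSet.ord ε ⟨0, c⟩ ⟨n, w⟩ := by
          rcases Nat.eq_zero_or_pos n with rfl | hn
          · exact ⟨w, by cases ε <;> exact Relation.ReflTransGen.refl⟩
          · obtain ⟨a, b, hab⟩ := exists_inHom w hn
            cases ε
            · exact ⟨a, hab.le_left⟩
            · exact ⟨b, hab.le_right⟩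
        obtain ⟨c, hc⟩ := this
        exact ord_trans ((toGlobSet_ord_iff hX hS).2 (h c.1 c.2 trivial)) hc
    · intro h
      obtain rfl : n = 0 := hS.dim_eq_zero h
      exact ⟨x.2, Or.inr ⟨rfl, fun y hy _ => (toGlobSet_ord_iff hX hS).1 (h ⟨0, y, hy⟩)⟩⟩
  · rw [hS.mem_bdry_succ ⟨n, x⟩]
    constructor
    · rintro ⟨_, h | ⟨rfl, h⟩⟩
      · exact Or.inl (Nat.lt_succ_iff.1 h)
      · exact Or.inr ⟨x, rfl, fun x' h1 h2 => (toGlobSet_ord_iff hX hS).2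
          (h x'.1 x'.2 ⟨congrArg Subtype.val h1.symm, congrArg Subtype.val h2.symm⟩)⟩
    · rintro (h | ⟨y, h, h'⟩)
      · exact ⟨x.2, Or.inl (Nat.lt_succ_iff.2 h)⟩
      · obtain rfl : n = k + 1 := congrArg Sigma.fst h
        obtain rfl : x = y := by simpa using h
        exact ⟨x.2, Or.inr ⟨rfl, fun y hy hp => (toGlobSet_ord_iff hX hS).1
          (h' ⟨y, hy⟩ (Subtype.ext hp.1.symm) (Subtype.ext hp.2.symm))⟩⟩

/-! ### Images of morphisms -/

/-- The image of a morphism. -/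
def Hom.im (f : X ⟶ Y) : Y.Sub where
  mem n := Set.range (f.app : X.cell n → Y.cell n)
  src_mem := by rintro n _ ⟨x, rfl⟩; exact ⟨X.src x, f.app_src x⟩
  tgt_mem := by rintro n _ ⟨x, rfl⟩; exact ⟨X.tgt x, f.app_tgt x⟩

theorem comp_app (f : X ⟶ Y) (g : Y ⟶ Z) {n : ℕ} (x : X.cell n) :
    (f ≫ g).app x = g.app (f.app x) := rfl

theorem id_app {n : ℕ} (x : X.cell n) : Hom.app (𝟙 X) x = x := rfl

/-- A morphism whose image lies in the image of an injective one factors through it. -/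
theorem Hom.exists_lift {f : X ⟶ Z} {g : Y ⟶ Z}
    (hg : ∀ n, Function.Injective (g.app : Y.cell n → Z.cell n))
    (h : ∀ (n : ℕ) (x : X.cell n), f.app x ∈ (Hom.im g).mem n) : ∃ k : X ⟶ Y, k ≫ g = f := by
  choose k hk using h
  refine ⟨⟨fun {n} x => k n x, fun {n} x => hg _ ?_, fun {n} x => hg _ ?_⟩,
    hom_ext fun n x => hk n x⟩
  · rw [hk, f.app_src, g.app_src, hk]
  · rw [hk, f.app_tgt, g.app_tgt, hk]

/-- Injective morphisms with the same image are isomorphic over their target. -/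
theorem Hom.exists_iso {f : X ⟶ Z} {g : Y ⟶ Z}
    (hf : ∀ n, Function.Injective (f.app : X.cell n → Z.cell n))
    (hg : ∀ n, Function.Injective (g.app : Y.cell n → Z.cell n))
    (h : Hom.im f = Hom.im g) : ∃ e : X ≅ Y, e.hom ≫ g = f := by
  obtain ⟨k, hk⟩ := Hom.exists_lift (f := f) hg fun n x => h ▸ ⟨x, rfl⟩
  obtain ⟨l, hl⟩ := Hom.exists_lift (f := g) hf fun n x => h.symm ▸ ⟨x, rfl⟩
  refine ⟨⟨k, l, hom_ext fun n x => hf n ?_, hom_ext fun n x => hg n ?_⟩, hk⟩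
  · rw [← comp_app, Category.assoc, hl, hk, id_app]
  · rw [← comp_app, Category.assoc, hk, hl, id_app]

theorem im_iso_comp (e : X ≅ Y) (f : Y ⟶ Z) : Hom.im (e.hom ≫ f) = Hom.im f := by
  refine Sub.ext (funext fun n => Set.ext fun z => ⟨?_, ?_⟩)
  · rintro ⟨x, rfl⟩; exact ⟨e.hom.app x, rfl⟩
  · rintro ⟨y, rfl⟩; exact ⟨e.inv.app y, by rw [comp_app, hom_app]⟩

theorem im_incl (S : X.Sub) : Hom.im S.incl = S := by
  refine Sub.ext (funext fun n => Set.ext fun z => ⟨?_, fun h => ⟨⟨z, h⟩, rfl⟩⟩)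
  rintro ⟨x, rfl⟩; exact x.2

theorem incl_injective (S : X.Sub) (n : ℕ) :
    Function.Injective (S.incl.app : S.toGlobSet.cell n → X.cell n) :=
  fun _ _ h => Subtype.ext h

theorem IsCard.of_iso (e : X ≅ Y) (hX : X.IsCard) : Y.IsCard where
  finite := by
    have := hX.finite
    refine Finite.of_injective (fun v : Y.Vertex => (⟨v.1, e.inv.app v.2⟩ : X.Vertex)) ?_
    rintro ⟨n, x⟩ ⟨m, y⟩ h
    obtain rfl : n = m := congrArg Sigma.fst h
    have h : e.inv.app x = e.inv.app y := by simpa using h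
    rw [← hom_app e x, h, hom_app]
  antisymm := by
    rintro ⟨n, x⟩ ⟨m, y⟩ h1 h2
    have h := hX.antisymm _ _ (Hom.le_app e.inv h1) (Hom.le_app e.inv h2)
    obtain rfl : n = m := congrArg Sigma.fst h
    have h : e.inv.app x = e.inv.app y := by simpa using h
    rw [← hom_app e x, h, hom_app]
  total := by
    rintro ⟨n, x⟩ ⟨m, y⟩
    have := hX.total ⟨n, e.inv.app x⟩ ⟨m, e.inv.app y⟩
    rw [← iso_le e, ← iso_le e] at this
    simpa only [hom_app] using this

/-- The image of the boundary is the boundary of the image. -/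
theorem im_bdry (hX : X.IsCard) (hY : Y.IsCard) (f : X ⟶ Y) (ε : Bool) (m : ℕ) :
    Hom.im ((X.bdry ε m).incl ≫ f) = (Hom.im f).bd ε m := by
  obtain ⟨e, he⟩ := Hom.exists_iso (f := f) (g := (Hom.im f).incl)
    (fun _ => Hom.app_injective hX hY f) (incl_injective _) (im_incl _).symm
  have hS : (Hom.im f).toGlobSet.IsCard := hX.of_iso e
  refine Sub.ext (funext fun n => Set.ext fun z => ⟨?_, fun h => ?_⟩)
  · rintro ⟨x, rfl⟩
    have := (Sub.mem_bd_iff hY hS _).2 (iso_bdry e x.2)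
    rwa [show (e.hom.app x.1).1 = f.app x.1 from congrArg (fun g : X ⟶ Y => g.app x.1) he] at this
  · obtain ⟨x, hx⟩ : ∃ x, e.hom.app x = ⟨z, h.1⟩ := ⟨_, hom_app e _⟩
    have h1 := iso_bdry e.symm ((Sub.mem_bd_iff hY hS ⟨z, h.1⟩).1 h)
    rw [← hx] at h1
    have h2 : x ∈ (X.bdry ε m).mem n := by simpa only [Iso.symm_hom, inv_app] using h1
    refine ⟨⟨x, h2⟩, ?_⟩
    have := congrArg (fun g : X ⟶ Y => g.app x) he
    have h3 := congrArg Subtype.val hx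
    exact this.symm.trans h3

end GlobSet

/-! ### Restrictions to the interval between consecutive vertices -/

namespace GlobCard

open GlobSet (Sub)

variable {X : GlobCard.{u}} {a b : X.cell 0}

theorem inHom_restr {n : ℕ} (w : (X.restr a b).cell n) :
    GlobSet.InHom X.toGlobSet a b (n := n + 1) w.1 :=
  X.isCard.mem_restrSub.1 w.2

theorem restr_le {u v : (X.restr a b).Vertex} (h : (X.restr a b).le u v) :
    X.le ⟨u.1 + 1, u.2.1⟩ ⟨v.1 + 1, v.2.1⟩ := by
  induction h with
  | refl => exact .refl
  | tail _ h ih =>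
    refine ih.tail ?_
    cases h with
    | src y => exact GlobSet.Prec.src (X := X.toGlobSet) (n := _ + 1) y.1
    | tgt y => exact GlobSet.Prec.tgt (X := X.toGlobSet) (n := _ + 1) y.1

theorem restr_le_iff {u v : (X.restr a b).Vertex} :
    (X.restr a b).le u v ↔ X.le ⟨u.1 + 1, u.2.1⟩ ⟨v.1 + 1, v.2.1⟩ := by
  refine ⟨restr_le, fun h => ?_⟩
  obtain ⟨n, x, hx⟩ := u
  obtain ⟨m, y, hy⟩ := v
  rcases (X.restr a b).isCard.total ⟨n, x, hx⟩ ⟨m, y, hy⟩ with h' | h'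
  · exact h'
  · have he := X.isCard.antisymm _ _ h (restr_le h')
    obtain rfl : n = m := by simpa using congrArg Sigma.fst he
    obtain rfl : x = y := eq_of_heq (Sigma.mk.inj he).2
    exact .refl

theorem restr_ord_iff {ε : Bool} {u v : (X.restr a b).Vertex} :
    (X.restr a b).ord ε u v ↔ X.ord ε ⟨u.1 + 1, u.2.1⟩ ⟨v.1 + 1, v.2.1⟩ := by
  cases ε
  · exact restr_le_iff
  · exact restr_le_iff

/-- Two vertices of `X(a,b)` are parallel there if and only if they are parallel in `X`. -/
theorem restr_par_iff : ∀ {n : ℕ} {x y : (X.restr a b).cell n},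
    (X.restr a b).Par x y ↔ GlobSet.Par X.toGlobSet (n := n + 1) x.1 y.1
  | 0, x, y => ⟨fun _ => ⟨(inHom_restr x).base.1.trans (inHom_restr y).base.1.symm,
      (inHom_restr x).base.2.trans (inHom_restr y).base.2.symm⟩, fun _ => trivial⟩
  | _ + 1, _, _ => ⟨fun h => ⟨congrArg Subtype.val h.1, congrArg Subtype.val h.2⟩,
      fun h => ⟨Subtype.ext h.1, Subtype.ext h.2⟩⟩

/-- The subfunctor of `X` with `0`-vertices `a`, `b` whose other vertices are those of the
subfunctor `S` of `X(a,b)`. -/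
def edge (S : (X.restr a b).toGlobSet.Sub) : X.toGlobSet.Sub where
  mem
    | 0 => {a, b}
    | n + 1 => {w | ∃ h : w ∈ (X.restrSub a b).mem n,
        (⟨w, h⟩ : (X.restr a b).cell n) ∈ S.mem n}
  src_mem {n x} h := by
    obtain ⟨h, hS⟩ := h
    rcases n with _ | n
    · exact Or.inl (X.isCard.mem_restrSub.1 h).base.1
    · exact ⟨_, S.src_mem hS⟩
  tgt_mem {n x} h := by
    obtain ⟨h, hS⟩ := h
    rcases n with _ | n
    · exact Or.inr (X.isCard.mem_restrSub.1 h).base.2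
    · exact ⟨_, S.tgt_mem hS⟩

theorem edge_between (hab : X.le ⟨0, a⟩ ⟨0, b⟩) {S : (X.restr a b).toGlobSet.Sub} : ∀ {n : ℕ}
    {w : X.cell n}, w ∈ (edge S).mem n → X.le ⟨0, a⟩ ⟨n, w⟩ ∧ X.le ⟨n, w⟩ ⟨0, b⟩
  | 0, _, h => by
    rcases h with rfl | rfl
    · exact ⟨.refl, hab⟩
    · exact ⟨hab, .refl⟩
  | _ + 1, _, ⟨h, _⟩ => ⟨(X.isCard.mem_restrSub.1 h).le_left, (X.isCard.mem_restrSub.1 h).le_right⟩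

theorem edge_rel {S : (X.restr a b).toGlobSet.Sub} {u v : (X.restr a b).Vertex} (h : S.Rel u v) :
    (edge S).Rel ⟨u.1 + 1, u.2.1⟩ ⟨v.1 + 1, v.2.1⟩ := by
  induction h with
  | refl => exact .refl
  | tail _ h ih =>
    obtain ⟨h, h1, h2⟩ := h
    refine ih.tail ⟨?_, ⟨Subtype.property _, h1⟩, ⟨Subtype.property _, h2⟩⟩
    cases h with
    | src y => exact GlobSet.Prec.src (X := X.toGlobSet) (n := _ + 1) y.1
    | tgt y => exact GlobSet.Prec.tgt (X := X.toGlobSet) (n := _ + 1) y.1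

/-- Inside `edge S` every vertex is reached from `a` and reaches `b`; for `a` and `b` themselves
this needs a vertex of `S` to pass through. -/
theorem edge_rel_ends {S : (X.restr a b).toGlobSet.Sub} (hS : (S.mem 0).Nonempty) :
    ∀ {n : ℕ} {w : X.cell n}, w ∈ (edge S).mem n →
      (edge S).Rel ⟨0, a⟩ ⟨n, w⟩ ∧ (edge S).Rel ⟨n, w⟩ ⟨0, b⟩
  | 0, w, h => by
    obtain ⟨c, hc⟩ := hS
    have h1 := Sub.rel_of_inHom (S := edge S) (n := 1) (w := c.1) ⟨c.2, hc⟩ (inHom_restr c)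
    have h2 := Relation.ReflTransGen.trans h1.1 h1.2
    rcases h with rfl | rfl
    · exact ⟨.refl, h2⟩
    · exact ⟨h2, .refl⟩
  | _ + 1, _, h => Sub.rel_of_inHom h (X.isCard.mem_restrSub.1 h.1)

theorem edge_tot {S : (X.restr a b).toGlobSet.Sub} (hS : (S.mem 0).Nonempty) (h : S.Tot) :
    (edge S).Tot := by
  rintro ⟨_ | n, x⟩ ⟨_ | m, y⟩ hx hy
  · rcases hx with rfl | rfl
    · exact Or.inl (edge_rel_ends hS hy).1
    · exact Or.inr (edge_rel_ends hS hy).2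
  · rcases hx with rfl | rfl
    · exact Or.inl (edge_rel_ends hS hy).1
    · exact Or.inr (edge_rel_ends hS hy).2
  · rcases hy with rfl | rfl
    · exact Or.inr (edge_rel_ends hS hx).1
    · exact Or.inl (edge_rel_ends hS hx).2
  · obtain ⟨hx, hx'⟩ := hx
    obtain ⟨hy, hy'⟩ := hy
    exact (h ⟨n, x, hx⟩ ⟨m, y, hy⟩ hx' hy').imp edge_rel edge_rel

theorem edge_sup (S T : (X.restr a b).toGlobSet.Sub) :
    edge (S.sup T) = (edge S).sup (edge T) := by
  refine Sub.ext (funext fun n => Set.ext fun w => ?_)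
  rcases n with _ | n
  · exact (or_self_iff).symm
  · exact exists_or

/-! ### Subfunctors supported by paths -/

/-- The subfunctor of `X` that a path of consecutive vertices supports, when `s` assigns a
subfunctor of `X(a,b)` to each edge from `a` to `b`. -/
def pathSupp (X : GlobCard.{u}) {H : X.cell 0 → X.cell 0 → Type v}
    (s : ∀ a b, H a b → (X.restr a b).toGlobSet.Sub) :
    ∀ {x y : X.cell 0}, EPath H x y → X.toGlobSet.Sub
  | _, _, .nil x => Sub.pt x
  | _, _, .cons c p => (edge (s _ _ c)).sup (pathSupp X s p)

section PathSupp

variable {H : X.cell 0 → X.cell 0 → Type v} {s : ∀ a b, H a b → (X.restr a b).toGlobSet.Sub}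

theorem left_mem_pathSupp : ∀ {x y : X.cell 0} (p : EPath H x y), x ∈ (pathSupp X s p).mem 0
  | _, _, .nil _ => rfl
  | _, _, .cons _ _ => Or.inl (Or.inl rfl)

theorem right_mem_pathSupp : ∀ {x y : X.cell 0} (p : EPath H x y), y ∈ (pathSupp X s p).mem 0
  | _, _, .nil _ => rfl
  | _, _, .cons _ p => Or.inr (right_mem_pathSupp p)

theorem mem_pt {x : X.cell 0} : ∀ {n : ℕ} {w : X.cell n}, w ∈ (Sub.pt x).mem n →
    (⟨n, w⟩ : X.Vertex) = ⟨0, x⟩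
  | 0, _, h => congrArg (Sigma.mk 0) h
  | _ + 1, _, h => h.elim

theorem consec_of_edge (hs : ∀ a b c, ((s a b c).mem 0).Nonempty) (c : H a b) : X.Consec a b :=
  X.consec_of_restr ⟨(hs a b c).some⟩

theorem pathSupp_between (hs : ∀ a b c, ((s a b c).mem 0).Nonempty) : ∀ {x y : X.cell 0}
    (p : EPath H x y) {n : ℕ} {w : X.cell n}, w ∈ (pathSupp X s p).mem n →
    X.le ⟨0, x⟩ ⟨n, w⟩ ∧ X.le ⟨n, w⟩ ⟨0, y⟩
  | _, _, .nil x, n, w, h => by rw [mem_pt h]; exact ⟨.refl, .refl⟩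
  | _, _, .cons c p, n, w, h => by
    have hc := (consec_of_edge hs c).le
    rcases h with h | h
    · exact ⟨(edge_between hc h).1,
        (edge_between hc h).2.trans (pathSupp_between hs p (left_mem_pathSupp p)).2⟩
    · exact ⟨hc.trans (pathSupp_between hs p h).1, (pathSupp_between hs p h).2⟩

/-- The first edge of a path meets the rest of the path in a single `0`-vertex. -/
theorem edge_inter_pathSupp (hs : ∀ a b c, ((s a b c).mem 0).Nonempty) {x y z : X.cell 0}
    (hxy : X.le ⟨0, x⟩ ⟨0, y⟩) {S : (X.restr x y).toGlobSet.Sub} (p : EPath H y z) {n : ℕ}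
    {w : X.cell n} (h : w ∈ (edge S).mem n) (h' : w ∈ (pathSupp X s p).mem n) :
    (⟨n, w⟩ : X.Vertex) = ⟨0, y⟩ :=
  X.isCard.antisymm _ _ (edge_between hxy h).2 (pathSupp_between hs p h').1

/-- A vertex of positive dimension in the hom from `x` to `y` does not lie on a path that starts
at `y`. -/
theorem notMem_pathSupp (hs : ∀ a b c, ((s a b c).mem 0).Nonempty) {x y z : X.cell 0}
    (p : EPath H y z) {n : ℕ} {w : X.cell n} (h : X.InHom x y w) :
    w ∉ (pathSupp X s p).mem n := fun h' =>
  X.isCard.not_le_of_ne h.lt.ne (pathSupp_between hs p h').1 h.le_right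

/-- If the edges of a path support globular cardinals, so does the path: its pieces are totally
ordered and each of them ends in the vertex in which the next one starts. -/
theorem pathSupp_tot (hs : ∀ a b c, ((s a b c).mem 0).Nonempty) (ht : ∀ a b c, (s a b c).Tot) :
    ∀ {x y : X.cell 0} (p : EPath H x y), (pathSupp X s p).Tot ∧
      ∀ (n : ℕ) (w : X.cell n), w ∈ (pathSupp X s p).mem n →
        (pathSupp X s p).Rel ⟨0, x⟩ ⟨n, w⟩
  | _, _, .nil x => by
    refine ⟨fun u v hu hv => ?_, fun n w hw => ?_⟩
    · rw [show u = _ from mem_pt hu, show v = _ from mem_pt hv]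
      exact Or.inl .refl
    · rw [mem_pt hw]
      exact .refl
  | x, z, .cons (y := y) c p => by
    obtain ⟨h1, h2⟩ := pathSupp_tot hs ht p
    have h3 := edge_tot (hs _ _ c) (ht _ _ c)
    have hl : ∀ {u v}, (edge (s _ _ c)).Rel u v → (pathSupp X s (.cons c p)).Rel u v :=
      fun h => h.mono fun _ _ => Or.inl
    have hr : ∀ {u v}, (pathSupp X s p).Rel u v → (pathSupp X s (.cons c p)).Rel u v :=
      fun h => h.mono fun _ _ => Or.inr
    have hmid : ∀ {n m : ℕ} {v : X.cell n} {w : X.cell m}, v ∈ (edge (s _ _ c)).mem n →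
        w ∈ (pathSupp X s p).mem m → (pathSupp X s (.cons c p)).Rel ⟨n, v⟩ ⟨m, w⟩ :=
      fun hv hw => (hl (edge_rel_ends (hs _ _ c) hv).2).trans (hr (h2 _ _ hw))
    refine ⟨fun u v hu hv => ?_, fun n w hw => ?_⟩
    · rcases hu with hu | hu <;> rcases hv with hv | hv
      · exact (h3 u v hu hv).imp hl hl
      · exact Or.inl (hmid hu hv)
      · exact Or.inr (hmid hv hu)
      · exact (h1 u v hu hv).imp hr hr
    · rcases hw with hw | hw
      · exact hl (edge_rel_ends (hs _ _ c) hw).1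
      · exact hmid (Or.inl rfl) hw

/-- If two paths with the same first step support the same subfunctor, what the first edge supports
and what the rest supports for one of them is contained in the same for the other. -/
theorem of_pathSupp_cons_eq (hs : ∀ a b c, ((s a b c).mem 0).Nonempty) {x y z z' : X.cell 0}
    (c c' : H x y) (p : EPath H y z) (p' : EPath H y z')
    (h : pathSupp X s (.cons c p) = pathSupp X s (.cons c' p')) :
    (∀ (n : ℕ) (w : (X.restr x y).cell n), w ∈ (s _ _ c).mem n → w ∈ (s _ _ c').mem n) ∧
      ∀ (n : ℕ) (w : X.cell n), w ∈ (pathSupp X s p).mem n → w ∈ (pathSupp X s p').mem n := by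
  constructor
  · intro n w hw
    have h1 : w.1 ∈ (pathSupp X s (.cons c p)).mem (n + 1) := Or.inl ⟨w.2, hw⟩
    rw [h] at h1
    rcases h1 with ⟨_, h1⟩ | h1
    · exact h1
    · exact absurd h1 (notMem_pathSupp hs p' (inHom_restr w))
  · intro n w hw
    have h1 : w ∈ (pathSupp X s (.cons c p)).mem n := Or.inr hw
    rw [h] at h1
    rcases h1 with h1 | h1
    · have he := edge_inter_pathSupp hs (consec_of_edge hs c).le p h1 hw
      obtain rfl : n = 0 := congrArg Sigma.fst he
      obtain rfl := eq_of_heq (Sigma.mk.inj he).2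
      exact left_mem_pathSupp p'
    · exact h1

/-- A path is determined by the subfunctor it supports: the next vertex is the unique successor,
and the edge to it is recovered by restriction. -/
theorem pathSupp_injective (hs : ∀ a b c, ((s a b c).mem 0).Nonempty)
    (hi : ∀ a b, Function.Injective (s a b)) : ∀ {x y y' : X.cell 0} (p : EPath H x y)
    (p' : EPath H x y'), pathSupp X s p = pathSupp X s p' →
    (⟨y, p⟩ : Σ y, EPath H x y) = ⟨y', p'⟩
  | _, _, _, .nil _, .nil _, _ => rfl
  | x, _, _, .nil _, .cons (y := z) c p, h => by
    have h1 : z ∈ (pathSupp X s (.nil x)).mem 0 := by rw [h]; exact Or.inl (Or.inr rfl)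
    exact absurd (Eq.symm h1) (consec_of_edge hs c).1
  | x, _, _, .cons (y := z) c p, .nil _, h => by
    have h1 : z ∈ (pathSupp X s (.nil x)).mem 0 := by rw [← h]; exact Or.inl (Or.inr rfl)
    exact absurd (Eq.symm h1) (consec_of_edge hs c).1
  | _, _, _, .cons c p, .cons c' p', h => by
    have hc := consec_of_edge hs c
    obtain rfl := hc.unique_right X.isCard (consec_of_edge hs c')
    obtain ⟨h1, h2⟩ := of_pathSupp_cons_eq hs c c' p p' h
    obtain ⟨h1', h2'⟩ := of_pathSupp_cons_eq hs c' c p' p h.symm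
    obtain rfl : c = c' := hi _ _ (Sub.ext (funext fun n => Set.ext fun w => ⟨h1 n w, h1' n w⟩))
    have := pathSupp_injective hs hi p p'
      (Sub.ext (funext fun n => Set.ext fun w => ⟨h2 n w, h2' n w⟩))
    cases this
    rfl

theorem pathSupp_append (hs : ∀ a b c, ((s a b c).mem 0).Nonempty) : ∀ {x y z : X.cell 0}
    (p : EPath H x y) (q : EPath H y z),
    pathSupp X s (p.append q) = (pathSupp X s q).sup (pathSupp X s p)
  | _, _, _, .nil x, q => by
    refine Sub.ext (funext fun n => Set.ext fun w => ⟨Or.inl, ?_⟩)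
    rintro (h | h)
    · exact h
    · have he := mem_pt h
      obtain rfl : n = 0 := congrArg Sigma.fst he
      obtain rfl := eq_of_heq (Sigma.mk.inj he).2
      exact left_mem_pathSupp q
  | _, _, _, .cons c p, q => by
    refine Sub.ext (funext fun n => ?_)
    simp only [EPath.append, pathSupp, pathSupp_append hs p q, Sub.sup]
    rw [Set.union_left_comm]

/-- The boundaries of positive level of a path are computed edge by edge, since vertices on
different edges are not parallel. -/
theorem pathSupp_map (hs : ∀ a b c, ((s a b c).mem 0).Nonempty) {ε : Bool} {m : ℕ}
    {f : ∀ a b, H a b → H a b} (hf : ∀ a b c, s a b (f a b c) = (s a b c).bd ε m) :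
    ∀ {x y : X.cell 0} (p : EPath H x y),
      pathSupp X s (p.map f) = (pathSupp X s p).bd ε (m + 1)
  | _, _, .nil x => by
    refine Sub.ext (funext fun n => Set.ext fun w => ⟨fun h => ⟨h, Or.inl ?_⟩, And.left⟩)
    rw [show n = 0 from congrArg Sigma.fst (mem_pt h)]
    exact Nat.succ_pos m
  | x, z, .cons (y := y) c p => by
    have ih := pathSupp_map hs hf p
    refine Sub.ext (funext fun n => Set.ext fun w => ?_)
    simp only [EPath.map, pathSupp, ih, hf]
    rcases n with _ | n
    · constructor
      · rintro (h | h)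
        · exact ⟨Or.inl h, Or.inl (Nat.succ_pos m)⟩
        · exact ⟨Or.inr h.1, Or.inl (Nat.succ_pos m)⟩
      · rintro ⟨h | h, _⟩
        · exact Or.inl h
        · exact Or.inr ⟨h, Or.inl (Nat.succ_pos m)⟩
    constructor
    · rintro (⟨h, h', h''⟩ | ⟨h, h'⟩)
      · refine ⟨Or.inl ⟨h, h'⟩, h''.imp Nat.succ_lt_succ ?_⟩
        rintro ⟨rfl, hw⟩
        refine ⟨rfl, ?_⟩
        rintro v (⟨hv, hv'⟩ | hv) hp
        · exact restr_ord_iff.1 (hw ⟨v, hv⟩ hv' (restr_par_iff.2 hp))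
        · exact absurd hv (notMem_pathSupp hs p (hp.inHom (X.isCard.mem_restrSub.1 h)))
      · refine ⟨Or.inr h, h'.imp id ?_⟩
        rintro ⟨hn, hw⟩
        refine ⟨hn, ?_⟩
        rintro v (⟨hv, hv'⟩ | hv) hp
        · refine absurd h (notMem_pathSupp (x := x) hs p ?_)
          exact GlobSet.Par.inHom (x := v) ⟨hp.1.symm, hp.2.symm⟩ (X.isCard.mem_restrSub.1 hv)
        · exact hw v hv hp
    · rintro ⟨⟨h, h'⟩ | h, hw⟩
      · refine Or.inl ⟨h, h', hw.imp Nat.lt_of_succ_lt_succ ?_⟩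
        rintro ⟨hn, hw⟩
        exact ⟨Nat.succ.inj hn, fun v hv hp =>
          restr_ord_iff.2 (hw v.1 (Or.inl ⟨v.2, hv⟩) (restr_par_iff.1 hp))⟩
      · exact Or.inr ⟨h, hw.imp id fun hw => ⟨hw.1, fun v hv hp => hw.2 v (Or.inr hv) hp⟩⟩

theorem pt_eq_bd_zero {S : X.toGlobSet.Sub} {ε : Bool} {x : X.cell 0} (hx : x ∈ S.mem 0)
    (h : ∀ y ∈ S.mem 0, X.ord ε ⟨0, x⟩ ⟨0, y⟩) : Sub.pt x = S.bd ε 0 := by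
  refine Sub.ext (funext fun n => Set.ext fun w => ⟨fun hw => ?_, ?_⟩)
  · have he := mem_pt hw
    obtain rfl : n = 0 := congrArg Sigma.fst he
    obtain rfl := eq_of_heq (Sigma.mk.inj he).2
    exact ⟨hx, Or.inr ⟨rfl, fun y hy _ => h y hy⟩⟩
  · rintro ⟨hw, h' | ⟨rfl, h'⟩⟩
    · omega
    · have := X.isCard.ord_antisymm (h' x hx trivial) (h w hw)
      exact eq_of_heq (Sigma.mk.inj this).2

theorem pathSupp_rel {R : ∀ a b, H a b → H a b → H a b → Prop}
    (hR : ∀ a b c d e, R a b c d e → s a b e = (s a b c).sup (s a b d)) {x y : X.cell 0}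
    {p q r : EPath H x y} (h : EPath.Rel R p q r) :
    pathSupp X s r = (pathSupp X s p).sup (pathSupp X s q) := by
  induction h with
  | nil => exact Sub.ext (funext fun n => (Set.union_self _).symm)
  | cons hc _ ih =>
    rw [pathSupp, ih, hR _ _ _ _ _ hc, edge_sup]
    refine Sub.ext (funext fun n => ?_)
    simp only [pathSupp, Sub.sup]
    rw [Set.union_union_union_comm]

/-- If, on each edge, two composable cells meet only in the boundary `f`, then so do two
sequences of such cells over the same vertices. -/
theorem pathSupp_rel_inter (hs : ∀ a b c, ((s a b c).mem 0).Nonempty)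
    {R : ∀ a b, H a b → H a b → H a b → Prop} {f : ∀ a b, H a b → H a b}
    (hR : ∀ a b c d e, R a b c d e → ∀ n w, w ∈ (s a b c).mem n → w ∈ (s a b d).mem n →
      w ∈ (s a b (f a b c)).mem n) {x y : X.cell 0}
    {p q r : EPath H x y} (h : EPath.Rel R p q r) {n : ℕ} {w : X.cell n}
    (hp : w ∈ (pathSupp X s p).mem n) (hq : w ∈ (pathSupp X s q).mem n) :
    w ∈ (pathSupp X s (p.map f)).mem n := by
  have hy : ∀ {y z : X.cell 0} (p : EPath H y z), (⟨n, w⟩ : X.Vertex) = ⟨0, y⟩ →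
      w ∈ (pathSupp X s p).mem n := by
    intro y z p he
    obtain rfl : n = 0 := congrArg Sigma.fst he
    obtain rfl := eq_of_heq (Sigma.mk.inj he).2
    exact left_mem_pathSupp p
  induction h with
  | nil => exact hp
  | @cons x y z c c' c'' p q r hc _ ih =>
    have hle := (consec_of_edge hs c).le
    rcases hp with hp | hp <;> rcases hq with hq | hq
    · refine Or.inl ?_
      rcases n with _ | n
      · exact hp
      · exact ⟨hp.1, hR _ _ _ _ _ hc _ _ hp.2 hq.2⟩
    · exact Or.inr (hy _ (edge_inter_pathSupp hs hle _ hp hq))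
    · exact Or.inr (hy _ (edge_inter_pathSupp hs hle _ hq hp))
    · exact Or.inr (ih hp hq)

end PathSupp

/-! ### Subfunctors supported by the cells of `𝔉 (Γ X)` -/

/-- `s` represents the cells of `𝔉 𝒢` faithfully by nonempty globular cardinals contained in `X`,
so that domains, codomains and dimensions are those of subfunctors, and composites are unions of
subfunctors that meet in the common boundary. -/
structure IsSupport (X : GlobCard.{u}) (G : EGraph.{u}) (s : G.Cell → X.toGlobSet.Sub) :
    Prop where
  tot : ∀ c, (s c).Tot
  nonempty : ∀ c, ((s c).mem 0).Nonempty
  injective : Function.Injective s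
  dom : ∀ m c, s (G.dom m c) = (s c).bd false m
  cod : ∀ m c, s (G.cod m c) = (s c).bd true m
  comp_sup : ∀ m c d e, G.Comp m c d e → s e = (s c).sup (s d)
  comp_inter : ∀ m c d e, G.Comp m c d e → ∀ n w, w ∈ (s c).mem n → w ∈ (s d).mem n →
    w ∈ (s (G.dom m c)).mem n
  isCell_iff : ∀ n c, G.IsCell n c ↔ ∀ m, n < m → (s c).mem m = ∅

theorem isSupport_empty (X : GlobCard.{u}) (s : EGraph.empty.{u}.Cell → X.toGlobSet.Sub) :
    IsSupport X EGraph.empty s where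
  tot c := c.1.elim
  nonempty c := c.1.elim
  injective c := c.1.elim
  dom _ c := c.1.elim
  cod _ c := c.1.elim
  comp_sup _ c := c.1.elim
  comp_inter _ c := c.1.elim
  isCell_iff _ c := c.1.elim

theorem isCell_iff_pathSupp {H : X.cell 0 → X.cell 0 → Type v}
    {s : ∀ a b, H a b → (X.restr a b).toGlobSet.Sub} {P : ∀ a b, H a b → Prop} {n : ℕ}
    (hP : ∀ a b c, P a b c ↔ ∀ m, n < m → (s a b c).mem m = ∅) : ∀ {x y : X.cell 0}
    (p : EPath H x y), p.All P ↔ ∀ m, n + 1 < m → (pathSupp X s p).mem m = ∅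
  | _, _, .nil x => ⟨fun _ m hm => by
      obtain ⟨m, rfl⟩ : ∃ k, m = k + 1 := ⟨m - 1, by omega⟩
      rfl, fun _ => trivial⟩
  | _, _, .cons c p => by
    have ih := isCell_iff_pathSupp hP p
    simp only [EPath.All, pathSupp, Sub.sup, ih, hP, Set.union_empty_iff, forall_and]
    refine and_congr_left fun _ => ⟨fun h m hm => ?_, fun h m hm => ?_⟩
    · obtain ⟨m, rfl⟩ : ∃ k, m = k + 1 := ⟨m - 1, by omega⟩
      refine Set.eq_empty_iff_forall_notMem.2 fun w ⟨hw, hw'⟩ => ?_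
      rw [h m (by omega)] at hw'
      exact hw'
    · refine Set.eq_empty_iff_forall_notMem.2 fun w hw => ?_
      have h1 : w.1 ∈ (edge (s _ _ c)).mem (m + 1) := ⟨w.2, hw⟩
      rw [h (m + 1) (by omega)] at h1
      exact h1

/-- If the cells on the edges of a graph with vertices `X_0` support subfunctors of the `X(a,b)`,
then the paths support subfunctors of `X`. -/
theorem IsSupport.mk_graph {E : X.cell 0 → X.cell 0 → EGraph.{u}}
    {s : ∀ a b, (E a b).Cell → (X.restr a b).toGlobSet.Sub}
    (hE : ∀ a b, IsSupport (X.restr a b) (E a b) (s a b)) :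
    IsSupport X (.mk (X.cell 0) E) fun c => pathSupp X s c.2.2 where
  tot c := (pathSupp_tot (fun a b => (hE a b).nonempty) (fun a b => (hE a b).tot) c.2.2).1
  nonempty c := ⟨_, left_mem_pathSupp c.2.2⟩
  injective := by
    have hs := fun a b => (hE a b).nonempty
    rintro ⟨x, y, p⟩ ⟨x', y', p'⟩ (h : pathSupp X s p = pathSupp X s p')
    obtain rfl : x = x' := by
      refine X.isCard.eq_of_le
        (pathSupp_between hs p ?_).1 (pathSupp_between hs p' ?_).1
      · exact h.symm ▸ left_mem_pathSupp p'
      · exact h ▸ left_mem_pathSupp p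
    have := pathSupp_injective hs (fun a b => (hE a b).injective) p p' h
    cases this
    rfl
  dom := by
    have hs := fun a b => (hE a b).nonempty
    rintro (_ | m) ⟨x, y, p⟩
    · exact pt_eq_bd_zero (left_mem_pathSupp p) fun z hz => (pathSupp_between hs p hz).1
    · exact pathSupp_map hs (fun a b => (hE a b).dom m) p
  cod := by
    have hs := fun a b => (hE a b).nonempty
    rintro (_ | m) ⟨x, y, p⟩
    · exact pt_eq_bd_zero (right_mem_pathSupp p) fun z hz => (pathSupp_between hs p hz).2
    · exact pathSupp_map hs (fun a b => (hE a b).cod m) p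
  comp_sup := by
    rintro (_ | m) _ _ _
    · rintro ⟨x, y, z, p, q, rfl, rfl, rfl⟩
      exact pathSupp_append (fun a b => (hE a b).nonempty) p q
    · rintro ⟨x, y, p, q, r, rfl, rfl, rfl, h⟩
      exact pathSupp_rel (fun a b => (hE a b).comp_sup m) h
  comp_inter := by
    have hs := fun a b => (hE a b).nonempty
    rintro (_ | m) _ _ _
    · rintro ⟨x, y, z, p, q, rfl, rfl, rfl⟩ n w hq hp
      have he := X.isCard.antisymm _ _ (pathSupp_between hs p hp).2 (pathSupp_between hs q hq).1
      obtain rfl : n = 0 := congrArg Sigma.fst he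
      exact eq_of_heq (Sigma.mk.inj he).2
    · rintro ⟨x, y, p, q, r, rfl, rfl, rfl, h⟩ n w hq hp
      exact pathSupp_rel_inter hs (fun a b => (hE a b).comp_inter m) h hq hp
  isCell_iff := by
    rintro (_ | n) ⟨x, y, p⟩
    · cases p with
      | nil =>
        refine ⟨fun _ m hm => ?_, fun _ => trivial⟩
        obtain ⟨m, rfl⟩ : ∃ k, m = k + 1 := ⟨m - 1, by omega⟩
        rfl
      | cons c p =>
        refine ⟨fun h => h.elim, fun h => ?_⟩
        obtain ⟨w, hw⟩ := (hE _ _).nonempty c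
        have h1 : w.1 ∈ (pathSupp X s (.cons c p)).mem 1 := Or.inl ⟨w.2, hw⟩
        rw [show _ = _ from h 1 one_pos] at h1
        exact h1.elim
    · exact isCell_iff_pathSupp (fun a b => (hE a b).isCell_iff n) p

/-- The subfunctor of `X` that a cell of `𝔉 (Γ X)` supports. As in `graphAux`, the recursion is on a
bound `n` for the dimension; the graph `graphAux 0 X` has no edges. -/
def supp : ∀ (n : ℕ) (X : GlobCard.{u}), (graphAux n X).Cell → X.toGlobSet.Sub
  | 0, X, c => pathSupp X (H := fun _ _ => EGraph.empty.Cell) (fun _ _ e => e.1.elim) c.2.2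
  | n + 1, X, c => pathSupp X (fun a b => supp n (X.restr a b)) c.2.2

theorem isSupport_supp : ∀ (n : ℕ) (X : GlobCard.{u}), IsSupport X (graphAux n X) (supp n X)
  | 0, _ => IsSupport.mk_graph (E := fun _ _ => .empty) fun _ _ => isSupport_empty _ _
  | n + 1, X => IsSupport.mk_graph fun a b => isSupport_supp n (X.restr a b)

end GlobCard

/-! ### Pushouts as unions -/

namespace GlobSet

variable {A B C D X : GlobSet.{u}}

/-- A commutative square of injections is a pushout if its two legs cover the corner and meet only
in the image of the common part. -/
theorem isPushout_of_cover {f : C ⟶ B} {g : C ⟶ A} {j : B ⟶ D} {i : A ⟶ D}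
    (w : f ≫ j = g ≫ i) (hi : ∀ n, Function.Injective (i.app : A.cell n → D.cell n))
    (hj : ∀ n, Function.Injective (j.app : B.cell n → D.cell n))
    (hcover : ∀ (n : ℕ) (x : D.cell n), (∃ b, j.app b = x) ∨ ∃ a, i.app a = x)
    (hmeet : ∀ (n : ℕ) (b : B.cell n) (a : A.cell n), j.app b = i.app a →
      ∃ c, f.app c = b ∧ g.app c = a) : IsPushout f g j i := by
  have hdesc : ∀ t : Limits.PushoutCocone f g, ∃ u : D ⟶ t.pt, j ≫ u = t.inl ∧ i ≫ u = t.inr := by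
    intro t
    have hb : ∀ (n : ℕ) (b : B.cell n) (a : A.cell n), j.app b = i.app a →
        t.inl.app b = t.inr.app a := by
      intro n b a h
      obtain ⟨c, rfl, rfl⟩ := hmeet n b a h
      exact congrArg (fun k : C ⟶ t.pt => k.app c) t.condition
    have hex : ∀ (n : ℕ) (x : D.cell n), ∃ z : t.pt.cell n,
        (∀ b, j.app b = x → z = t.inl.app b) ∧ ∀ a, i.app a = x → z = t.inr.app a := by
      rintro n x
      rcases hcover n x with ⟨b, rfl⟩ | ⟨a, rfl⟩
      · exact ⟨t.inl.app b, fun b' h => by rw [hj n h], fun a h => hb n b a h.symm⟩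
      · exact ⟨t.inr.app a, fun b h => (hb n b a h).symm, fun a' h => by rw [hi n h]⟩
    choose u hu1 hu2 using hex
    refine ⟨⟨fun {n} x => u n x, fun {n} x => ?_, fun {n} x => ?_⟩, ?_, ?_⟩
    · rcases hcover _ x with ⟨b, rfl⟩ | ⟨a, rfl⟩
      · rw [hu1 _ _ b rfl, hu1 _ _ (B.src b) (j.app_src b), t.inl.app_src]
      · rw [hu2 _ _ a rfl, hu2 _ _ (A.src a) (i.app_src a), t.inr.app_src]
    · rcases hcover _ x with ⟨b, rfl⟩ | ⟨a, rfl⟩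
      · rw [hu1 _ _ b rfl, hu1 _ _ (B.tgt b) (j.app_tgt b), t.inl.app_tgt]
      · rw [hu2 _ _ a rfl, hu2 _ _ (A.tgt a) (i.app_tgt a), t.inr.app_tgt]
    · exact hom_ext fun n b => hu1 _ _ b rfl
    · exact hom_ext fun n a => hu2 _ _ a rfl
  choose u hu1 hu2 using hdesc
  refine ⟨⟨w⟩, ⟨Limits.PushoutCocone.IsColimit.mk w u hu1 hu2 fun t m h1 h2 => ?_⟩⟩
  refine hom_ext fun n x => ?_
  rcases hcover n x with ⟨b, rfl⟩ | ⟨a, rfl⟩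
  · exact congrArg (fun k : B ⟶ t.pt => k.app b) (h1.trans (hu1 t).symm)
  · exact congrArg (fun k : A ⟶ t.pt => k.app a) (h2.trans (hu2 t).symm)

/-- The legs of a pushout cover its corner, since the union of their images already has the
universal property. -/
theorem cover_of_isPushout {f : C ⟶ B} {g : C ⟶ A} {j : B ⟶ D} {i : A ⟶ D}
    (h : IsPushout f g j i) {n : ℕ} (x : D.cell n) : (∃ b, j.app b = x) ∨ ∃ a, i.app a = x := by
  let U := (Hom.im j).sup (Hom.im i)
  have him : ∀ {E : GlobSet.{u}} (k : E ⟶ D), (∀ n x, k.app x ∈ U.mem n) →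
      ∃ l : E ⟶ U.toGlobSet, l ≫ U.incl = k := fun k hk =>
    Hom.exists_lift (incl_injective U) fun n x => (im_incl U).symm ▸ hk n x
  obtain ⟨j', hj'⟩ := him j fun n x => Or.inl ⟨x, rfl⟩
  obtain ⟨i', hi'⟩ := him i fun n x => Or.inr ⟨x, rfl⟩
  have hw : f ≫ j' = g ≫ i' := hom_ext fun n c => incl_injective U n (by
    rw [← comp_app, ← comp_app, Category.assoc, Category.assoc, hj', hi', h.w])
  have hid : h.desc j' i' hw ≫ U.incl = 𝟙 D := h.hom_ext (by simp [hj']) (by simp [hi'])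
  have hx : ((h.desc j' i' hw).app x).1 = x := congrArg (fun k : D ⟶ D => k.app x) hid
  rw [← hx]
  exact ((h.desc j' i' hw).app x).2

end GlobSet

namespace GlobCard

open GlobSet (Sub Hom)

namespace Over

variable {X : GlobCard.{u}}

theorem map_injective (γ : X.Over) (n : ℕ) :
    Function.Injective (γ.map.app : γ.left.cell n → X.cell n) :=
  Hom.app_injective γ.left.isCard X.isCard γ.map

/-- The cell of `𝔉 X` that a morphism represents is determined by the image of the morphism. -/
theorem equiv_iff_im_eq {γ γ' : X.Over} : γ ≈ γ' ↔ Hom.im γ.map = Hom.im γ'.map :=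
  ⟨fun ⟨e, h⟩ => h ▸ GlobSet.im_iso_comp e γ'.map,
    fun h => Hom.exists_iso γ.map_injective γ'.map_injective h⟩

theorem im_bdry (ε : Bool) (m : ℕ) (γ : X.Over) :
    Hom.im (γ.bdry ε m).map = (Hom.im γ.map).bd ε m :=
  GlobSet.im_bdry γ.left.isCard X.isCard γ.map ε m

theorem IsComp.im_bdry_eq {m : ℕ} {β α δ : X.Over} (h : IsComp m β α δ) :
    Hom.im (β.bdry false m).map = Hom.im (α.bdry true m).map := by
  obtain ⟨φ, i, j, hφ, -⟩ := h
  rw [show (β.bdry false m).map = φ.hom ≫ (α.bdry true m).map from hφ.symm]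
  exact GlobSet.im_iso_comp φ _

theorem IsComp.im_eq {m : ℕ} {β α δ : X.Over} (h : IsComp m β α δ) :
    Hom.im δ.map = (Hom.im β.map).sup (Hom.im α.map) := by
  obtain ⟨φ, i, j, -, hp, hi, hj⟩ := h
  refine Sub.ext (funext fun n => Set.ext fun z => ⟨?_, ?_⟩)
  · rintro ⟨x, rfl⟩
    rw [← hi, ← hj]
    rcases GlobSet.cover_of_isPushout hp x with ⟨b, rfl⟩ | ⟨a, rfl⟩
    · exact Or.inl ⟨b, rfl⟩
    · exact Or.inr ⟨a, rfl⟩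
  · rw [← hi, ← hj]
    rintro (⟨b, rfl⟩ | ⟨a, rfl⟩)
    · exact ⟨j.app b, rfl⟩
    · exact ⟨i.app a, rfl⟩

/-- A union is a composite when its two parts meet in their common boundary. -/
theorem isComp_of_im {m : ℕ} {β α δ : X.Over}
    (h : Hom.im (β.bdry false m).map = Hom.im (α.bdry true m).map)
    (hδ : Hom.im δ.map = (Hom.im β.map).sup (Hom.im α.map))
    (hmeet : ∀ n z, z ∈ (Hom.im β.map).mem n → z ∈ (Hom.im α.map).mem n →
      z ∈ (Hom.im (β.bdry false m).map).mem n) : IsComp m β α δ := by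
  obtain ⟨φ, hφ⟩ := Hom.exists_iso (β.bdry false m).map_injective (α.bdry true m).map_injective h
  obtain ⟨i, hi⟩ := Hom.exists_lift (f := α.map) δ.map_injective fun n x => hδ ▸ Or.inr ⟨x, rfl⟩
  obtain ⟨j, hj⟩ := Hom.exists_lift (f := β.map) δ.map_injective fun n x => hδ ▸ Or.inl ⟨x, rfl⟩
  have hφ' : ∀ {n : ℕ} (c : (β.bdry false m).left.cell n),
      α.map.app (φ.hom.app c).1 = β.map.app c.1 := fun c =>
    congrArg (fun k : (β.bdry false m).left.toGlobSet ⟶ X.toGlobSet => k.app c) hφ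
  have hi' : ∀ {n : ℕ} (a : α.left.cell n), δ.map.app (i.app a) = α.map.app a := fun a =>
    congrArg (fun k : α.left.toGlobSet ⟶ X.toGlobSet => k.app a) hi
  have hj' : ∀ {n : ℕ} (b : β.left.cell n), δ.map.app (j.app b) = β.map.app b := fun b =>
    congrArg (fun k : β.left.toGlobSet ⟶ X.toGlobSet => k.app b) hj
  refine ⟨φ, i, j, hφ, GlobSet.isPushout_of_cover ?_ ?_ ?_ ?_ ?_, hi, hj⟩
  · refine GlobSet.hom_ext fun n c => δ.map_injective n ?_
    exact (hj' _).trans ((hφ' c).symm.trans (hi' _).symm)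
  · intro n a a' he
    exact α.map_injective n (by rw [← hi', he, hi'])
  · intro n b b' he
    exact β.map_injective n (by rw [← hj', he, hj'])
  · intro n x
    have hx : δ.map.app x ∈ (Hom.im δ.map).mem n := ⟨x, rfl⟩
    rw [hδ] at hx
    rcases hx with ⟨b, hb⟩ | ⟨a, ha⟩
    · exact Or.inl ⟨b, δ.map_injective n ((hj' b).trans hb)⟩
    · exact Or.inr ⟨a, δ.map_injective n ((hi' a).trans ha)⟩
  · intro n b a he
    have hba : β.map.app b = α.map.app a := by rw [← hj', he, hi']
    obtain ⟨c, hc⟩ := hmeet n (β.map.app b) ⟨b, rfl⟩ ⟨a, hba.symm⟩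
    have hc' : c.1 = b := β.map_injective n hc
    exact ⟨c, hc', α.map_injective n ((hφ' c).trans (hc.trans hba))⟩

end Over

/-! ### The comparison map -/

section Compare

variable {X Y : GlobCard.{u}}

theorem edge_im_subset (γ : Y.toGlobSet ⟶ X.toGlobSet) (a b : Y.cell 0) {n : ℕ} {w : X.cell n}
    (h : w ∈ (edge (Hom.im (restrHom γ a b))).mem n) : w ∈ (Hom.im γ).mem n := by
  rcases n with _ | n
  · rcases h with rfl | rfl
    · exact ⟨a, rfl⟩
    · exact ⟨b, rfl⟩
  · obtain ⟨h, y, hy⟩ := h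
    exact ⟨y.1, congrArg Subtype.val hy⟩

variable {γ : Y.toGlobSet ⟶ X.toGlobSet} {H : X.cell 0 → X.cell 0 → Type u}
  {s : ∀ a b, H a b → (X.restr a b).toGlobSet.Sub}
  {g : ∀ a b, Y.Consec a b → H (γ.app a) (γ.app b)}

theorem pathSupp_ofChain_subset (hg : ∀ a b h, s _ _ (g a b h) = Hom.im (restrHom γ a b)) :
    ∀ (a : Y.cell 0) (l : List (Y.cell 0)) (h : (a :: l).IsChain fun a b => Y.Consec a b)
      (n : ℕ) (w : X.cell n),
      w ∈ (pathSupp X s (EPath.ofChain (c := fun a b => Y.Consec a b) γ.app g a l h).2).mem n →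
      w ∈ (Hom.im γ).mem n
  | a, [], h, n, w, hw => by
    have he := mem_pt hw
    obtain rfl : n = 0 := congrArg Sigma.fst he
    obtain rfl := eq_of_heq (Sigma.mk.inj he).2
    exact ⟨a, rfl⟩
  | a, b :: l, h, n, w, hw => by
    rcases hw with hw | hw
    · rw [hg] at hw
      exact edge_im_subset γ a b hw
    · exact pathSupp_ofChain_subset hg b l _ n w hw

theorem app_mem_pathSupp_ofChain : ∀ (a : Y.cell 0) (l : List (Y.cell 0))
    (h : (a :: l).IsChain fun a b => Y.Consec a b), ∀ c ∈ a :: l,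
      γ.app c ∈
        (pathSupp X s (EPath.ofChain (c := fun a b => Y.Consec a b) γ.app g a l h).2).mem 0
  | a, [], h, c, hc => by
    rw [List.mem_singleton] at hc
    rw [hc]
    exact left_mem_pathSupp _
  | a, b :: l, h, c, hc => by
    rcases List.mem_cons.1 hc with rfl | hc
    · exact left_mem_pathSupp _
    · exact Or.inr (app_mem_pathSupp_ofChain b l _ c hc)

/-- The interval between consecutive vertices `c`, `d` of an increasing list is one of the edges of
the path: `d` comes directly after `c`, since successors are unique. -/
theorem edge_subset_pathSupp_ofChain
    (hg : ∀ a b h, s _ _ (g a b h) = Hom.im (restrHom γ a b)) :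
    ∀ (a : Y.cell 0) (l : List (Y.cell 0)) (h : (a :: l).IsChain fun a b => Y.Consec a b),
      (a :: l).Pairwise (fun a b => Y.le ⟨0, a⟩ ⟨0, b⟩ ∧ a ≠ b) →
      ∀ c ∈ a :: l, ∀ d ∈ a :: l, Y.Consec c d → ∀ (n : ℕ) (w : X.cell n),
      w ∈ (edge (Hom.im (restrHom γ c d))).mem n →
      w ∈ (pathSupp X s (EPath.ofChain (c := fun a b => Y.Consec a b) γ.app g a l h).2).mem n
  | a, [], h, _, c, hc, d, hd, hcd, n, w, hw => by
    rw [List.mem_singleton] at hc hd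
    exact absurd (hc.trans hd.symm) hcd.1
  | a, b :: l, h, hp, c, hc, d, hd, hcd, n, w, hw => by
    rw [List.pairwise_cons] at hp
    rcases List.mem_cons.1 hc with rfl | hc'
    · obtain rfl := hcd.unique_right Y.isCard (List.isChain_cons_cons.1 h).1
      refine Or.inl ?_
      rw [hg]
      exact hw
    · rcases List.mem_cons.1 hd with rfl | hd'
      · exact absurd (Y.isCard.eq_of_le (hp.1 c hc').1 hcd.le) (hp.1 c hc').2
      · exact Or.inr (edge_subset_pathSupp_ofChain hg b l _ hp.2 c hc' d hd' hcd n w hw)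

/-- The subfunctor that `L γ` supports is the image of `γ`. -/
theorem supp_compareAux : ∀ (n : ℕ) (X Y : GlobCard.{u}) (hY : Nonempty (Y.cell 0))
    (γ : Y.toGlobSet ⟶ X.toGlobSet), X.DimLE n →
    supp n X (compareAux n X Y hY γ) = Hom.im γ
  | 0, X, Y, hY, γ, hX => by
    set y₀ := Y.vertexList.head (Y.vertexList_ne_nil hY)
    -- without vertices of positive dimension the linear order of `X` is equality
    have hle : ∀ u v : X.Vertex, X.le u v → u = v := by
      intro u v h
      rcases Relation.ReflTransGen.cases_head h with h | ⟨_, h, _⟩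
      · exact h
      · cases h with
        | src y => exact ((hX _ (Nat.succ_pos _)).false y).elim
        | tgt y => exact ((hX _ (Nat.succ_pos _)).false y).elim
    refine Sub.ext (funext fun n => Set.ext fun w => ⟨fun hw => ?_, ?_⟩)
    · have he := mem_pt hw
      obtain rfl : n = 0 := congrArg Sigma.fst he
      obtain rfl := eq_of_heq (Sigma.mk.inj he).2
      exact ⟨y₀, rfl⟩
    · rintro ⟨y, rfl⟩
      rcases n with _ | n
      · have h : (⟨0, γ.app y⟩ : X.Vertex) = ⟨0, γ.app y₀⟩ := by
          rcases X.isCard.total ⟨0, γ.app y⟩ ⟨0, γ.app y₀⟩ with h | h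
          · exact hle _ _ h
          · exact (hle _ _ h).symm
        exact eq_of_heq (Sigma.mk.inj h).2
      · exact ((hX _ (Nat.succ_pos _)).false (γ.app y)).elim
  | n + 1, X, Y, hY, γ, hX => by
    have hg : ∀ (a b : Y.cell 0) (h : Y.Consec a b),
        supp n (X.restr (γ.app a) (γ.app b)) (compareAux n (X.restr (γ.app a) (γ.app b))
          (Y.restr a b) (Y.restr_nonempty h) (restrHom γ a b)) = Hom.im (restrHom γ a b) :=
      fun a b h => supp_compareAux n _ _ _ _ (GlobSet.DimLE.restr hX _ _)
    -- each vertex of `Y` of positive dimension lies between two consecutive `0`-vertices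
    have hl := List.cons_head_tail (Y.vertexList_ne_nil hY)
    have hmem : ∀ c, c ∈ Y.vertexList.head (Y.vertexList_ne_nil hY) :: Y.vertexList.tail :=
      fun c => hl.symm ▸ Y.mem_vertexList c
    refine Sub.ext (funext fun k => Set.ext fun w => ⟨fun hw => ?_, ?_⟩)
    · exact pathSupp_ofChain_subset hg _ _ _ k w hw
    · rintro ⟨y, rfl⟩
      rcases k with _ | k
      · exact app_mem_pathSupp_ofChain _ _ _ y (hmem y)
      · obtain ⟨a, b, hab⟩ := GlobSet.exists_inHom y (Nat.succ_pos k)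
        have hy := Y.isCard.mem_restrSub.2 hab
        refine edge_subset_pathSupp_ofChain hg _ _ _ (hl.symm ▸ Y.pairwise_vertexList) a (hmem a)
          b (hmem b) (Y.isCard.consec_of_inHom hab) _ _ ?_
        exact ⟨((restrHom γ a b).app (n := k) ⟨y, hy⟩).2, ⟨y, hy⟩, rfl⟩

theorem supp_compare (γ : X.Over) : supp X.dim X (X.compare ⟦γ⟧) = Hom.im γ.map :=
  supp_compareAux X.dim X γ.left γ.nonempty γ.map X.dimLE_dim

/-- Surjectivity holds because a cell of `𝔉 (Γ X)` is the image under `L` of the inclusion of the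
subfunctor that it supports. -/
theorem compare_bijective (X : GlobCard.{u}) : Function.Bijective X.compare := by
  have hs := isSupport_supp X.dim X
  constructor
  · intro x x'
    induction x using Quotient.inductionOn with | h γ =>
    induction x' using Quotient.inductionOn with | h γ' =>
    intro h
    refine Quotient.sound (Over.equiv_iff_im_eq.2 ?_)
    rw [← supp_compare, ← supp_compare, h]
  · intro c
    let S := supp X.dim X c
    have hS : S.toGlobSet.IsCard := (Sub.isCard_iff_tot X.isCard S).2 (hs.tot c)
    let γ : X.Over := ⟨⟨S.toGlobSet, hS⟩, (hs.nonempty c).to_subtype, S.incl⟩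
    exact ⟨⟦γ⟧, hs.injective ((supp_compare γ).trans (GlobSet.im_incl S))⟩

theorem compare_isCell_iff (n : ℕ) (x : X.free.Cell) :
    X.Gam.toEGraph.free.IsCell n (X.compare x) ↔ X.free.IsCell n x := by
  induction x using Quotient.inductionOn with | h γ =>
  refine ((isSupport_supp X.dim X).isCell_iff n _).trans ?_
  rw [supp_compare]
  refine forall_congr' fun m => imp_congr_right fun _ => ?_
  exact Set.range_eq_empty_iff

theorem compare_dom (m : ℕ) (x : X.free.Cell) :
    X.compare (X.free.dom m x) = X.Gam.toEGraph.free.dom m (X.compare x) := by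
  induction x using Quotient.inductionOn with | h γ =>
  refine (isSupport_supp X.dim X).injective ((supp_compare (γ.bdry false m)).trans ?_)
  rw [Over.im_bdry, ← supp_compare]
  exact ((isSupport_supp X.dim X).dom m _).symm

theorem compare_cod (m : ℕ) (x : X.free.Cell) :
    X.compare (X.free.cod m x) = X.Gam.toEGraph.free.cod m (X.compare x) := by
  induction x using Quotient.inductionOn with | h γ =>
  refine (isSupport_supp X.dim X).injective ((supp_compare (γ.bdry true m)).trans ?_)
  rw [Over.im_bdry, ← supp_compare]
  exact ((isSupport_supp X.dim X).cod m _).symm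

/-- Both sides say that the boundaries agree and that the supports of `y` and `x` have that of `z`
as their union. -/
theorem compare_comp_iff (m : ℕ) (y x z : X.free.Cell) :
    X.Gam.toEGraph.free.Comp m (X.compare y) (X.compare x) (X.compare z) ↔
      X.free.Comp m y x z := by
  have hs := isSupport_supp X.dim X
  have hD := X.Gam.isOrdinal.free_isOmegaCat
  constructor
  · induction y using Quotient.inductionOn with | h β =>
    induction x using Quotient.inductionOn with | h α =>
    induction z using Quotient.inductionOn with | h δ =>
    intro h
    have hb : X.free.dom m ⟦β⟧ = X.free.cod m ⟦α⟧ := X.compare_bijective.1 <|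
      (compare_dom m ⟦β⟧).trans
        (((hD.comp_exists m _ _).2 ⟨_, h⟩).trans (compare_cod m ⟦α⟧).symm)
    have h1 := hs.comp_sup m _ _ _ h
    have h2 := hs.comp_inter m _ _ _ h
    have h3 : supp X.dim X ((graphAux X.dim X).dom m (X.compare ⟦β⟧)) =
        Hom.im (β.bdry false m).map :=
      (congrArg (supp X.dim X) (compare_dom m ⟦β⟧).symm).trans (supp_compare (β.bdry false m))
    rw [h3] at h2
    simp only [supp_compare] at h1 h2
    exact ⟨β, α, δ, rfl, rfl, rfl, Over.isComp_of_im
      (Over.equiv_iff_im_eq.1 (Quotient.exact hb)) h1 h2⟩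
  · rintro ⟨β, α, δ, rfl, rfl, rfl, h⟩
    have hb : X.free.dom m ⟦β⟧ = X.free.cod m ⟦α⟧ :=
      Quotient.sound (Over.equiv_iff_im_eq.2 h.im_bdry_eq)
    obtain ⟨c, hc⟩ := (hD.comp_exists m _ _).1 ((compare_dom m ⟦β⟧).symm.trans
      ((congrArg X.compare hb).trans (compare_cod m ⟦α⟧)))
    have : c = X.compare ⟦δ⟧ := hs.injective (by
      rw [hs.comp_sup m _ _ _ hc, supp_compare, supp_compare, supp_compare, h.im_eq])
    rwa [this] at hc

end Compare

end GlobCard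

/-! ### Transport of the axioms -/

section Transport

variable {C : OmegaData.{u}} {D : OmegaData.{v}} {F : C.Cell → D.Cell}

/-- The axioms of an `ω`-category are reflected by a bijection that preserves and reflects the
structure. -/
theorem OmegaData.IsOmegaCat.of_bijective (hD : D.IsOmegaCat) (hF : Function.Bijective F)
    (hcell : ∀ n x, D.IsCell n (F x) ↔ C.IsCell n x)
    (hdom : ∀ m x, F (C.dom m x) = D.dom m (F x)) (hcod : ∀ m x, F (C.cod m x) = D.cod m (F x))
    (hcomp : ∀ m y x z, D.Comp m (F y) (F x) (F z) ↔ C.Comp m y x z) : C.IsOmegaCat where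
  isCell_iff n x := by rw [← hcell, hD.isCell_iff, ← hdom, hF.1.eq_iff]
  finite_dim := hD.finite_dim.imp fun n h x => (hcell n x).1 (h _)
  dom_dom m n x h := hF.1 (by simp only [hdom]; exact hD.dom_dom m n _ h)
  cod_cod m n x h := hF.1 (by simp only [hcod]; exact hD.cod_cod m n _ h)
  dom_cod m n x h := hF.1 (by simp only [hdom, hcod]; exact hD.dom_cod m n _ h)
  cod_dom m n x h := hF.1 (by simp only [hdom, hcod]; exact hD.cod_dom m n _ h)
  dom_dom' m n x h := hF.1 (by simp only [hdom]; exact hD.dom_dom' m n _ h)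
  cod_dom' m n x h := hF.1 (by simp only [hdom, hcod]; exact hD.cod_dom' m n _ h)
  dom_cod' m n x h := hF.1 (by simp only [hdom, hcod]; exact hD.dom_cod' m n _ h)
  cod_cod' m n x h := hF.1 (by simp only [hcod]; exact hD.cod_cod' m n _ h)
  comp_exists m y x := by
    rw [← hF.1.eq_iff, hdom, hcod, hD.comp_exists, hF.2.exists]
    simp only [hcomp]
  comp_unique m y x z z' h h' :=
    hF.1 (hD.comp_unique m _ _ _ _ ((hcomp ..).2 h) ((hcomp ..).2 h'))
  dom_comp m y x z h := hF.1 (by simp only [hdom]; exact hD.dom_comp m _ _ _ ((hcomp ..).2 h))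
  cod_comp m y x z h := hF.1 (by simp only [hcod]; exact hD.cod_comp m _ _ _ ((hcomp ..).2 h))
  comp_dom m x := by rw [← hcomp, hdom]; exact hD.comp_dom m _
  cod_comp_self m x := by rw [← hcomp, hcod]; exact hD.cod_comp_self m _
  assoc m z y x zy yx w h h' := by
    rw [← hcomp, ← hcomp m z]
    exact hD.assoc m _ _ _ _ _ _ ((hcomp ..).2 h) ((hcomp ..).2 h')
  dom_comp' m n y x z hmn h := by
    rw [← hcomp, hdom, hdom, hdom]; exact hD.dom_comp' m n _ _ _ hmn ((hcomp ..).2 h)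
  cod_comp' m n y x z hmn h := by
    rw [← hcomp, hcod, hcod, hcod]; exact hD.cod_comp' m n _ _ _ hmn ((hcomp ..).2 h)
  interchange m n y' y x' x a' a b c w hmn h1 h2 h3 h4 := by
    rw [← hcomp, ← hcomp n]
    exact hD.interchange m n _ _ _ _ _ _ _ _ _ hmn ((hcomp ..).2 h1) ((hcomp ..).2 h2)
      ((hcomp ..).2 h3) ((hcomp ..).2 h4)

theorem isOmegaIso_of_bijective (hF : Function.Bijective F)
    (hcell : ∀ n x, D.IsCell n (F x) ↔ C.IsCell n x)
    (hdom : ∀ m x, F (C.dom m x) = D.dom m (F x)) (hcod : ∀ m x, F (C.cod m x) = D.cod m (F x))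
    (hcomp : ∀ m y x z, D.Comp m (F y) (F x) (F z) ↔ C.Comp m y x z) : IsOmegaIso C D F := by
  obtain ⟨G, hGF, hFG⟩ := Function.bijective_iff_has_inverse.1 hF
  refine ⟨⟨fun n x => (hcell n x).2, hdom, hcod, fun m y x z => (hcomp m y x z).2⟩, G,
    ⟨fun n x h => ?_, fun m x => hF.1 ?_, fun m x => hF.1 ?_, fun m y x z h => ?_⟩, hGF, hFG⟩
  · rw [← hcell, hFG]; exact h
  · rw [hdom, hFG, hFG]
  · rw [hcod, hFG, hFG]
  · rw [← hcomp, hFG, hFG, hFG]; exact h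

end Transport

theorem mainTheorem6 (X : GlobCard.{u}) :
    X.free.IsOmegaCat ∧ X.Gam.toEGraph.free.IsOmegaCat ∧
      IsOmegaIso X.free X.Gam.toEGraph.free X.compare :=
  have hD := X.Gam.isOrdinal.free_isOmegaCat
  ⟨hD.of_bijective X.compare_bijective X.compare_isCell_iff X.compare_dom X.compare_cod
    X.compare_comp_iff, hD, isOmegaIso_of_bijective X.compare_bijective X.compare_isCell_iff
    X.compare_dom X.compare_cod X.compare_comp_iff⟩
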